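/- All graphs are finite, undirected and simple. For a graph $G$ and $A\subseteq V(G)$, let $N_G(A)=\bigcup_{x\in A}N_G(x)$ be the union of the neighbourhoods of the vertices of $A$. A graph is $t$-connected if it has more than $t$ vertices and remains connected after the deletion of any fewer than $t$ vertices. A $P_{\ge 3}$-factor of $G$ is a spanning subgraph of $G$ each of whose components is a path with at least three vertices. $G$ is a $P_{\ge 3}$-factor covered graph if every edge of $G$ lies in some $P_{\ge 3}$-factor of $G$, and $G$ is a $P_{\ge 3}$-factor uniform graph if $G-e$ is a $P_{\ge 3}$-factor covered graph for every edge $e$ of $G$. Theorem 1.4. Let $k\ge 1$ be an integer and let $\gamma$ be a real number with $\frac13\le\gamma\le 1$. (i) Let $G$ be a $(k+2)$-connected graph of order $n\ge 5k+3-\frac{3}{5\gamma-1}$. If $$|N_G(A)|>\gamma(n-3k-2)+k+2$$ for every independent set $A$ of $G$ with $|A|=\lfloor\gamma(2k+1)\rfloor$, then $G$ is a $P_{\ge 3}$-factor uniform graph. (ii) (Sharpness.) The connectivity and neighbourhood conditions in (i) cannot be replaced by "$(k+1)$-connected" and "$|N_G(A)|\ge\gamma(n-3k-2)+k+1$": if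 $\gamma=\frac{b}{2k+1}$ for some nonnegative integer $b$, then there is a $(k+1)$-connected graph $G$ of order $n=5k+3\ge 5k+3-\frac{3}{5\gamma-1}$ such that $|N_G(A)|\ge\gamma(n-3k-2)+k+1$ for every independent set $A$ of $G$ with $|A|=\lfloor\gamma(2k+1)\rfloor$, but $G$ is not a $P_{\ge 3}$-factor uniform graph. -/

import Mathlib

universe u

/-- `N_G(A)`: the union of the neighbourhoods of the vertices of `A`. -/
def SimpleGraph.nbhd {V : Type u} (G : SimpleGraph V) (A : Set V) : Set V :=
  ⋃ x ∈ A, G.neighborSet x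

/-- `G` is `k`-connected: it has more than `k` vertices, and deleting fewer than `k` vertices
always leaves a connected graph. -/
def SimpleGraph.IsKConnected {V : Type u} (G : SimpleGraph V) (k : ℕ) : Prop :=
  k < Nat.card V ∧ ∀ X : Set V, X.ncard < k → (G.induce Xᶜ).Connected

/-- `H` is a `P_{≥ d}`-factor of `G`: a spanning subgraph of `G` (so a graph on the same vertex
set, all of whose edges are edges of `G`) in which every component is a path on at least `d`
vertices. -/
def SimpleGraph.IsPathFactor {V : Type u} (d : ℕ) (G H : SimpleGraph V) : Prop :=
  H ≤ G ∧ ∀ C : H.ConnectedComponent,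
    ∃ m : ℕ, d ≤ m ∧ Nonempty (C.toSimpleGraph ≃g SimpleGraph.pathGraph m)

/-- `G` is a `P_{≥ d}`-factor covered graph: every edge of `G` lies in some `P_{≥ d}`-factor
of `G`. -/
def SimpleGraph.IsPathFactorCovered {V : Type u} (d : ℕ) (G : SimpleGraph V) : Prop :=
  ∀ e ∈ G.edgeSet, ∃ H : SimpleGraph V, SimpleGraph.IsPathFactor d G H ∧ e ∈ H.edgeSet

/-- `G` is a `P_{≥ d}`-factor uniform graph: `G - e` is a `P_{≥ d}`-factor covered graph for
every edge `e` of `G`. -/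
def SimpleGraph.IsPathFactorUniform {V : Type u} (d : ℕ) (G : SimpleGraph V) : Prop :=
  ∀ e ∈ G.edgeSet, SimpleGraph.IsPathFactorCovered d (G.deleteEdges {e})

/-! Part (i) rests on the sufficiency half of Kaneko's criterion: a vertex set splits into paths
with at least three vertices if deleting any `X` leaves at most `2|X|` sun components. `IsSun` keeps
only the features of suns that are needed: leaves, and a short path from any vertex whose removal
leaves a path partition.

The criterion (`fac_of_kan`) follows by induction on vertices, then on edges. If some `X` attains
the bound, Hall's theorem gives each `x` in `X` two suns, threaded on one path through `x`;
induction partitions the other components. If some `X` has slack one, an uncrossing argument gives a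
partition unless every vertex of `X` has a leaf. Leaves propagate: if there is no partition, a
neighbour of a vertex carrying a leaf is that leaf or carries one itself. The whole set then
consists of pairs with a leaf and is a sun, which the case `X = ∅` excludes. If every nonempty `X`
has slack two and there is no leaf, an edge can be deleted without violating the condition.

To cover an edge `uv`, delete the other edges at `u` (`pend`): in any partition of the new graph the
path of `u` starts with `u, v`. Kaneko's condition holds there except in two configurations, in
which a factor is built directly.

The component bounds come from the hypotheses. If `|X| ≥ k + 2` and at least `2|X| - 3` components
remain, one vertex from each of `⌊γ(2k+1)⌋` components that are small on average gives an
independent set with too few neighbours. So at most `2|X| - 4` remain, and deleting an edge adds at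
most one. Smaller `X` are handled by connectivity.

For (ii), join `K_{k+1}` to `2k + 1` disjoint edges. Each of these edges must send a factor edge to
the clique, but a factor using a clique edge has room for only `2k` of them. -/

namespace PathFac

open Set

section Factors

variable {V : Type u}

/-! ### Connectivity and path partitions of vertex sets -/

/-- `C` is nonempty and induces a connected subgraph, expressed through cuts. -/
def ConnOn (G : SimpleGraph V) (C : Set V) : Prop :=
  C.Nonempty ∧ ∀ A ⊆ C, A.Nonempty → (∀ a ∈ A, ∀ b ∈ C, G.Adj a b → b ∈ A) → A = C

/-- `C` is the vertex set of a connected component of the subgraph of `G` induced by `W`. -/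
def IsCompOn (G : SimpleGraph V) (W C : Set V) : Prop :=
  C ⊆ W ∧ ConnOn G C ∧ ∀ a ∈ C, ∀ b ∈ W, G.Adj a b → b ∈ C

/-- `W` can be partitioned into vertex sets of paths of `G` with at least three vertices. -/
inductive Fac (G : SimpleGraph V) : Set V → Prop
  | empty : Fac G ∅
  | cons {l : List V} {W : Set V} (hn : l.Nodup) (hc : l.IsChain G.Adj) (hl : 3 ≤ l.length)
      (hd : ∀ x ∈ l, x ∉ W) (h : Fac G W) : Fac G ({x | x ∈ l} ∪ W)

theorem Fac.union {G : SimpleGraph V} {A B : Set V} (hA : Fac G A) (hB : Fac G B)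
    (hd : Disjoint A B) : Fac G (A ∪ B) := by
  induction hA with
  | empty => simpa using hB
  | @cons l W hn hc hl hd' h ih =>
    rw [Set.union_assoc]
    rw [Set.disjoint_union_left] at hd
    refine Fac.cons hn hc hl ?_ (ih hd.2)
    rintro x hx (h1 | h1)
    · exact hd' x hx h1
    · exact Set.disjoint_left.1 hd.1 hx h1

theorem Fac.mono {G G' : SimpleGraph V} {W : Set V} (h : Fac G W)
    (hG : ∀ a ∈ W, ∀ b ∈ W, G.Adj a b → G'.Adj a b) : Fac G' W := by
  induction h with
  | empty => exact Fac.empty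
  | @cons l W hn hc hl hd h ih =>
    refine Fac.cons hn ?_ hl hd (ih fun a ha b hb => hG a (Or.inr ha) b (Or.inr hb))
    exact List.IsChain.imp_of_mem_imp (fun a b ha hb hab => hG a (Or.inl ha) b (Or.inl hb) hab) hc

theorem Fac.exists_path {G : SimpleGraph V} {W : Set V} (h : Fac G W) {v : V} (hv : v ∈ W) :
    ∃ l : List V, l.Nodup ∧ l.IsChain G.Adj ∧ 3 ≤ l.length ∧ v ∈ l ∧ (∀ x ∈ l, x ∈ W) ∧
      Fac G (W \ {x | x ∈ l}) := by
  induction h with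
  | empty => exact absurd hv (Set.notMem_empty v)
  | @cons l W hn hc hl hd h ih =>
    rcases hv with hv | hv
    · refine ⟨l, hn, hc, hl, hv, fun x hx => Or.inl hx, ?_⟩
      have : ({x | x ∈ l} ∪ W) \ {x | x ∈ l} = W := by
        ext x; simp only [mem_sdiff, mem_union, mem_ofPred_eq]
        constructor
        · rintro ⟨h1 | h1, h2⟩
          · exact absurd h1 h2
          · exact h1
        · intro h1; exact ⟨Or.inr h1, fun h2 => hd x h2 h1⟩
      rwa [this]
    · obtain ⟨m, mn, mc, ml, vm, mW, hm⟩ := ih hv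
      refine ⟨m, mn, mc, ml, vm, fun x hx => Or.inr (mW x hx), ?_⟩
      have : ({x | x ∈ l} ∪ W) \ {x | x ∈ m} = {x | x ∈ l} ∪ (W \ {x | x ∈ m}) := by
        ext x; simp only [mem_sdiff, mem_union, mem_ofPred_eq]
        constructor
        · tauto
        · rintro (h1 | h1)
          · exact ⟨Or.inl h1, fun h2 => hd x h1 (mW x h2)⟩
          · exact ⟨Or.inr h1.1, h1.2⟩
      rw [this]
      exact Fac.cons hn hc hl (fun x hx hx' => hd x hx hx'.1) hm

theorem Fac.of_path_diff {G : SimpleGraph V} {W : Set V} {l : List V} (hn : l.Nodup)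
    (hc : l.IsChain G.Adj) (hl : 3 ≤ l.length) (hW : ∀ x ∈ l, x ∈ W)
    (h : Fac G (W \ {x | x ∈ l})) : Fac G W := by
  have := Fac.cons hn hc hl (fun x hx hx' => hx'.2 hx) h
  have hsub : {x | x ∈ l} ⊆ W := hW
  rwa [Set.union_sdiff_cancel hsub] at this

/-- A vertex whose only neighbour is `w` can be taken as the first vertex of its path. -/
theorem Fac.exists_path_of_leaf {G : SimpleGraph V} {W : Set V} (h : Fac G W) {v w : V}
    (hv : v ∈ W) (hw : ∀ y ∈ W, G.Adj v y → y = w) :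
    ∃ t : List V, (v :: w :: t).Nodup ∧ (v :: w :: t).IsChain G.Adj ∧ t ≠ [] ∧
      (∀ x ∈ v :: w :: t, x ∈ W) ∧ Fac G (W \ {x | x ∈ v :: w :: t}) := by
  obtain ⟨l, ln, lc, ll, vl, lW, hl⟩ := h.exists_path hv
  obtain ⟨p, q, rfl⟩ := List.append_of_mem vl
  have key : ∀ p q : List V, (p ++ v :: q).Nodup → (p ++ v :: q).IsChain G.Adj →
      (∀ x ∈ p ++ v :: q, x ∈ W) → q ≠ [] → p = [] := by
    intro p q hn hc hW hq
    obtain ⟨b, q, rfl⟩ := List.exists_cons_of_ne_nil hq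
    rcases List.eq_nil_or_concat p with rfl | ⟨p, a, rfl⟩
    · rfl
    · exfalso
      have hc' : (p ++ a :: v :: b :: q).IsChain G.Adj := by simpa using hc
      have h1 := List.isChain_append_cons_cons.1 hc'
      have hva : a = w := hw a (hW a (by simp)) h1.2.1.symm
      have hvb : b = w := hw b (hW b (by simp)) (List.isChain_cons_cons.1 h1.2.2).1
      subst hva; subst hvb
      have hn' : (p ++ b :: v :: b :: q).Nodup := by simpa using hn
      simp [List.nodup_append] at hn'
  by_cases hq : q = []
  · subst hq
    have hr : (p ++ [v]).reverse = v :: p.reverse := by simp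
    obtain ⟨b, s, hs⟩ : ∃ b s, p.reverse = b :: s := by
      apply List.exists_cons_of_ne_nil
      intro h0
      have : p = [] := by simpa using h0
      subst this; simp at ll
    have hc' : (v :: b :: s).IsChain G.Adj := by
      rw [← hs, ← hr, List.isChain_reverse]
      exact lc.imp fun a b h => h.symm
    have hmem : ∀ x, x ∈ v :: b :: s ↔ x ∈ p ++ [v] := by
      intro x; rw [← hs, ← hr, List.mem_reverse]
    obtain rfl : b = w := hw b (lW b ((hmem b).1 (by simp))) (List.isChain_cons_cons.1 hc').1
    refine ⟨s, ?_, hc', ?_, fun x hx => lW x ((hmem x).1 hx), ?_⟩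
    · rw [← hs, ← hr]; exact List.nodup_reverse.2 ln
    · rintro rfl
      have : p.reverse.length = 1 := by rw [hs]; rfl
      simp at this; simp [this] at ll
    · simpa only [hmem] using hl
  · obtain rfl := key p q ln lc lW hq
    obtain ⟨b, q, rfl⟩ := List.exists_cons_of_ne_nil hq
    obtain rfl : b = w := hw b (lW b (by simp)) (List.isChain_cons_cons.1 lc).1
    refine ⟨q, ln, lc, ?_, lW, hl⟩
    rintro rfl; simp at ll

theorem Fac.three_le {G : SimpleGraph V} {W : Set V} (h : Fac G W)
    (hW : W.Nonempty) : ∃ a ∈ W, ∃ b ∈ W, ∃ c ∈ W, a ≠ b ∧ a ≠ c ∧ b ≠ c := by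
  obtain ⟨v, hv⟩ := hW
  obtain ⟨l, ln, -, ll, -, lW, -⟩ := h.exists_path hv
  match l, ll with
  | a :: b :: c :: t, _ =>
    refine ⟨a, lW a (by simp), b, lW b (by simp), c, lW c (by simp), ?_⟩
    simp at ln
    tauto

theorem Fac.sUnion [Finite V] {G : SimpleGraph V} {𝒞 : Set (Set V)} (h : ∀ C ∈ 𝒞, Fac G C)
    (hd : 𝒞.PairwiseDisjoint id) : Fac G (⋃₀ 𝒞) := by
  induction 𝒞, 𝒞.toFinite using Set.Finite.induction_on with
  | empty => simpa using Fac.empty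
  | @insert C 𝒞 hC _ ih =>
    rw [Set.sUnion_insert]
    refine (h C (by simp)).union (ih (fun D hD => h D (by simp [hD]))
      (hd.subset (Set.subset_insert _ _))) ?_
    rw [Set.disjoint_sUnion_right]
    intro D hD
    exact hd (by simp) (by simp [hD]) (fun h => hC (h ▸ hD))

/-! Components -/

theorem ConnOn.congr {G G' : SimpleGraph V} {C : Set V}
    (hG : ∀ a ∈ C, ∀ b ∈ C, G.Adj a b ↔ G'.Adj a b) (h : ConnOn G C) : ConnOn G' C :=
  ⟨h.1, fun A hA hA0 hAc => h.2 A hA hA0 fun a ha b hb hab =>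
    hAc a ha b hb ((hG a (hA ha) b hb).1 hab)⟩

theorem connOn_singleton (G : SimpleGraph V) (v : V) : ConnOn G {v} := by
  refine ⟨Set.singleton_nonempty v, fun A hA hA0 _ => ?_⟩
  exact (Set.subset_singleton_iff_eq.1 hA).resolve_left hA0.ne_empty

theorem ConnOn.exists_adj {G : SimpleGraph V} {W A : Set V} (h : ConnOn G W) (hA : A ⊆ W)
    (hA0 : A.Nonempty) (hAW : A ≠ W) : ∃ a ∈ A, ∃ b ∈ W, b ∉ A ∧ G.Adj a b := by
  by_contra hcon
  push Not at hcon
  exact hAW (h.2 A hA hA0 fun a ha b hb hab => by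
    by_contra hbA; exact hcon a ha b hb hbA hab)

theorem IsCompOn.subset_of_mem {G : SimpleGraph V} {W C D : Set V} (hC : IsCompOn G W C)
    (hD : IsCompOn G W D) {v : V} (hv : v ∈ C) (hv' : v ∈ D) : C ⊆ D := by
  have := hC.2.1.2 (C ∩ D) Set.inter_subset_left ⟨v, hv, hv'⟩ fun a ha b hb hab =>
    ⟨hb, hD.2.2 a ha.2 b (hC.1 hb) hab⟩
  exact Set.inter_eq_left.1 this

theorem IsCompOn.eq_of_mem {G : SimpleGraph V} {W C D : Set V} (hC : IsCompOn G W C)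
    (hD : IsCompOn G W D) {v : V} (hv : v ∈ C) (hv' : v ∈ D) : C = D :=
  (hC.subset_of_mem hD hv hv').antisymm (hD.subset_of_mem hC hv' hv)

theorem IsCompOn.disjoint {G : SimpleGraph V} {W C D : Set V} (hC : IsCompOn G W C)
    (hD : IsCompOn G W D) (hne : C ≠ D) : Disjoint C D :=
  Set.disjoint_left.2 fun _ hv hv' => hne (hC.eq_of_mem hD hv hv')

theorem pairwiseDisjoint_of_isCompOn {G : SimpleGraph V} {W : Set V} {𝒞 : Set (Set V)}
    (h : ∀ C ∈ 𝒞, IsCompOn G W C) : 𝒞.PairwiseDisjoint id :=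
  fun C hC D hD hne => (h C hC).disjoint (h D hD) hne

/-- The component is the intersection of all subsets of `W` that contain `v` and are closed under
adjacency. A closed part of it that misses `v` would have a complement in it that is a smaller such
subset. -/
theorem exists_isCompOn (G : SimpleGraph V) {W : Set V} {v : V} (hv : v ∈ W) :
    ∃ C, IsCompOn G W C ∧ v ∈ C := by
  let 𝒜 : Set (Set V) := {A | A ⊆ W ∧ v ∈ A ∧ ∀ a ∈ A, ∀ b ∈ W, G.Adj a b → b ∈ A}
  have hle : ∀ A ∈ 𝒜, ⋂₀ 𝒜 ⊆ A := fun A hA => Set.sInter_subset_of_mem hA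
  have hW : W ∈ 𝒜 := ⟨subset_rfl, hv, fun _ _ b hb _ => hb⟩
  have hv0 : v ∈ ⋂₀ 𝒜 := Set.mem_sInter.2 fun A hA => hA.2.1
  have hcl : ∀ a ∈ ⋂₀ 𝒜, ∀ b ∈ W, G.Adj a b → b ∈ ⋂₀ 𝒜 := fun a ha b hb hab =>
    Set.mem_sInter.2 fun A hA => hA.2.2 a (hle A hA ha) b hb hab
  refine ⟨⋂₀ 𝒜, ⟨hle W hW, ⟨⟨v, hv0⟩, fun A hA hA0 hAc => ?_⟩, hcl⟩, hv0⟩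
  by_cases hvA : v ∈ A
  · refine hA.antisymm (hle A ⟨hA.trans (hle W hW), hvA, fun a ha b hb hab => ?_⟩)
    exact hAc a ha b (hcl a (hA ha) b hb hab) hab
  · exfalso
    obtain ⟨y, hy⟩ := hA0
    have : ⋂₀ 𝒜 \ A ∈ 𝒜 := by
      refine ⟨Set.sdiff_subset.trans (hle W hW), ⟨hv0, hvA⟩, fun a ha b hb hab => ?_⟩
      have hb' := hcl a ha.1 b hb hab
      exact ⟨hb', fun hbA => ha.2 (hAc b hbA a ha.1 hab.symm)⟩
    exact (hle _ this (hA hy)).2 hy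

theorem sUnion_isCompOn (G : SimpleGraph V) (W : Set V) : ⋃₀ {C | IsCompOn G W C} = W := by
  apply Set.Subset.antisymm
  · exact Set.sUnion_subset fun C hC => hC.1
  · intro v hv
    obtain ⟨C, hC, hvC⟩ := exists_isCompOn G hv
    exact ⟨C, hC, hvC⟩

theorem ConnOn.isCompOn {G : SimpleGraph V} {W : Set V} (h : ConnOn G W) : IsCompOn G W W :=
  ⟨subset_rfl, h, fun _ _ _ hb _ => hb⟩

theorem ConnOn.eq_of_isCompOn {G : SimpleGraph V} {W C : Set V} (h : ConnOn G W)
    (hC : IsCompOn G W C) : C = W :=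
  h.2 C hC.1 hC.2.1.1 hC.2.2

theorem IsCompOn.congr {G G' : SimpleGraph V} {W C : Set V}
    (hG : ∀ a ∈ C, ∀ b ∈ W, G.Adj a b ↔ G'.Adj a b) (h : IsCompOn G W C) : IsCompOn G' W C :=
  ⟨h.1, h.2.1.congr fun a ha b hb => hG a ha b (h.1 hb),
    fun a ha b hb hab => h.2.2 a ha b hb ((hG a ha b hb).2 hab)⟩

theorem IsCompOn.restrict {G : SimpleGraph V} {W U C : Set V} (h : IsCompOn G W C) (hC : C ⊆ U)
    (hU : U ⊆ W) : IsCompOn G U C :=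
  ⟨hC, h.2.1, fun a ha b hb => h.2.2 a ha b (hU hb)⟩

theorem IsCompOn.enlarge {G : SimpleGraph V} {W U C : Set V} (h : IsCompOn G U C) (hU : U ⊆ W)
    (hn : ∀ a ∈ C, ∀ b ∈ W, G.Adj a b → b ∈ U) : IsCompOn G W C :=
  ⟨h.1.trans hU, h.2.1, fun a ha b hb hab => h.2.2 a ha b (hn a ha b hb hab) hab⟩

theorem IsCompOn.trans_diff {G : SimpleGraph V} {W C Y D : Set V} (hC : IsCompOn G W C)
    (hD : IsCompOn G (C \ Y) D) : IsCompOn G (W \ Y) D :=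
  hD.enlarge (Set.sdiff_subset_sdiff_left hC.1) fun a ha b hb hab =>
    ⟨hC.2.2 a (hD.1 ha).1 b hb.1 hab, hb.2⟩

/-! ### Suns and Kaneko's condition -/

/-- `S` is a sun: a connected graph which is a single vertex, or in which every vertex has a
partner such that one of the two is a leaf and the remaining vertices have a path factor. -/
def IsSun (G : SimpleGraph V) (S : Set V) : Prop :=
  ConnOn G S ∧ ((∃ v, S = {v}) ∨ ∀ v ∈ S, ∃ w ∈ S, G.Adj v w ∧
    ((∀ y ∈ S, G.Adj v y → y = w) ∨ (∀ y ∈ S, G.Adj w y → y = v)) ∧ Fac G (S \ {v, w}))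

/-- The sun components of the subgraph induced by `W`. -/
def suns (G : SimpleGraph V) (W : Set V) : Set (Set V) := {C | IsCompOn G W C ∧ IsSun G C}

theorem IsSun.congr {G G' : SimpleGraph V} {C : Set V}
    (hG : ∀ a ∈ C, ∀ b ∈ C, G.Adj a b ↔ G'.Adj a b) (h : IsSun G C) : IsSun G' C := by
  refine ⟨h.1.congr hG, h.2.imp id fun h2 v hv => ?_⟩
  obtain ⟨w, hw, hvw, hl, hf⟩ := h2 v hv
  refine ⟨w, hw, (hG v hv w hw).1 hvw, ?_, hf.mono fun a ha b hb => (hG a ha.1 b hb.1).1⟩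
  refine hl.imp (fun h y hy hvy => h y hy ((hG v hv y hy).2 hvy))
    (fun h y hy hvy => h y hy ((hG w hw y hy).2 hvy))

theorem isSun_singleton (G : SimpleGraph V) (v : V) : IsSun G {v} :=
  ⟨connOn_singleton G v, Or.inl ⟨v, rfl⟩⟩

/-- This is how a sun is used in gluing: wherever a path enters it from outside, the path can absorb
one or two vertices and leave a partitionable rest. -/
theorem IsSun.exists_lobe {G : SimpleGraph V} {S : Set V} (h : IsSun G S) {v : V} (hv : v ∈ S) :
    ∃ t : List V, (v :: t).Nodup ∧ (v :: t).IsChain G.Adj ∧ (t = [] → S = {v}) ∧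
      (∀ x ∈ v :: t, x ∈ S) ∧ Fac G (S \ {x | x ∈ v :: t}) := by
  rcases h.2 with ⟨u, rfl⟩ | h2
  · obtain rfl : v = u := hv
    refine ⟨[], by simp, by simp, by simp, by simp, ?_⟩
    have : ({v} : Set V) \ {x | x ∈ [v]} = ∅ := by ext x; simp
    rw [this]; exact Fac.empty
  · obtain ⟨w, hw, hvw, -, hf⟩ := h2 v hv
    refine ⟨[w], by simp [hvw.ne], by simp [hvw], by simp, ?_, ?_⟩
    · simp [hv, hw]
    · have : {x | x ∈ [v, w]} = ({v, w} : Set V) := by ext x; simp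
      rwa [this]

/-- Kaneko's condition for the subgraph induced by `W`. -/
def Kan (G : SimpleGraph V) (W : Set V) : Prop :=
  ∀ X ⊆ W, (suns G (W \ X)).ncard ≤ 2 * X.ncard

theorem suns_congr {G G' : SimpleGraph V} {W : Set V}
    (hG : ∀ a ∈ W, ∀ b ∈ W, G.Adj a b ↔ G'.Adj a b) : suns G W = suns G' W := by
  ext C
  constructor
  · rintro ⟨h1, h2⟩
    exact ⟨h1.congr fun a ha b hb => hG a (h1.1 ha) b hb,
      h2.congr fun a ha b hb => hG a (h1.1 ha) b (h1.1 hb)⟩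
  · rintro ⟨h1, h2⟩
    exact ⟨h1.congr fun a ha b hb => (hG a (h1.1 ha) b hb).symm,
      h2.congr fun a ha b hb => (hG a (h1.1 ha) b (h1.1 hb)).symm⟩

/-- Deleting part of a component that is not a sun leaves the old suns intact, so new suns are
additional. Hence Kaneko's condition passes to such components. -/
theorem ncard_suns_add_le [Finite V] {G : SimpleGraph V} {U C Y : Set V} (hC : IsCompOn G U C)
    (hs : ¬ IsSun G C) (hY : Y ⊆ C) :
    (suns G U).ncard + (suns G (C \ Y)).ncard ≤ (suns G (U \ Y)).ncard := by
  have hd : Disjoint (suns G U) (suns G (C \ Y)) := by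
    rw [Set.disjoint_left]
    rintro D ⟨h1, h1'⟩ ⟨h2, -⟩
    obtain ⟨v, hv⟩ := h1.2.1.1
    exact hs (h1.eq_of_mem hC hv (h2.1 hv).1 ▸ h1')
  rw [← Set.ncard_union_eq hd]
  refine Set.ncard_le_ncard ?_ (Set.toFinite _)
  rintro D (⟨h1, h2⟩ | ⟨h1, h2⟩)
  · refine ⟨h1.restrict (fun x hx => ⟨h1.1 hx, fun hxY => ?_⟩) Set.sdiff_subset, h2⟩
    exact hs (h1.eq_of_mem hC hx (hY hxY) ▸ h2)
  · exact ⟨hC.trans_diff h1, h2⟩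

/-! ### Assigning suns by Hall's theorem and gluing them -/

/-- `x` has a neighbour in `S`. -/
def Touches (G : SimpleGraph V) (x : V) (S : Set V) : Prop := ∃ s ∈ S, G.Adj x s

/-- Hall's theorem for an assignment in which every `x ∈ X` receives exactly two members. -/
theorem exists_assignment {α β : Type*} [Finite α] [Finite β] [Nonempty α] (X : Set α) (𝒮 : Set β)
    (N : α → β → Prop) (hcard : 2 * X.ncard ≤ 𝒮.ncard)
    (hall : ∀ 𝒞 ⊆ 𝒮, 𝒞.ncard ≤ 2 * {x | x ∈ X ∧ ∃ S ∈ 𝒞, N x S}.ncard) :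
    ∃ p : β → α, (∀ S ∈ 𝒮, p S ∈ X ∧ N (p S) S) ∧
      ∀ x ∈ X, ∃ S₁ ∈ 𝒮, ∃ S₂ ∈ 𝒮, S₁ ≠ S₂ ∧ p S₁ = x ∧ p S₂ = x ∧
        ∀ S ∈ 𝒮, p S = x → S = S₁ ∨ S = S₂ := by
  classical
  have := Fintype.ofFinite α
  have := Fintype.ofFinite β
  -- Doubling each `x` by a `Bool` turns a two-to-one assignment into an ordinary matching, which
  -- the cardinality bound makes onto.
  let t : 𝒮 → Finset (α × Bool) := fun S => Finset.univ.filter fun q => q.1 ∈ X ∧ N q.1 S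
  have hall' : ∀ s : Finset 𝒮, s.card ≤ (s.biUnion t).card := by
    intro s
    have h1 := hall (Subtype.val '' (s : Set 𝒮)) (by rintro _ ⟨S, -, rfl⟩; exact S.2)
    rw [Set.ncard_image_of_injective _ Subtype.val_injective, Set.ncard_coe_finset] at h1
    refine h1.trans (le_of_eq ?_)
    have : s.biUnion t = ({x | x ∈ X ∧ ∃ S ∈ Subtype.val '' (s : Set 𝒮), N x S} : Set α).toFinset
        ×ˢ (Finset.univ : Finset Bool) := by
      ext ⟨x, b⟩
      simp [t]
      tauto
    rw [this, Finset.card_product, Set.ncard_eq_toFinset_card']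
    simp [mul_comm]
  obtain ⟨f, hf, hft⟩ := (Finset.all_card_le_biUnion_card_iff_exists_injective t).1 hall'
  have hft' : ∀ S : 𝒮, (f S).1 ∈ X ∧ N (f S).1 S := fun S => by
    have := hft S
    simpa [t] using this
  have hsurj : Set.range f = X ×ˢ (Set.univ : Set Bool) := by
    apply Set.eq_of_subset_of_ncard_le
    · rintro _ ⟨S, rfl⟩
      exact ⟨(hft' S).1, trivial⟩
    · rw [Set.ncard_prod, Set.ncard_univ, Nat.card_eq_fintype_card, Fintype.card_bool,
        ← Set.image_univ, Set.ncard_image_of_injective _ hf, Set.ncard_univ,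
        Nat.card_coe_set_eq]
      omega
    · exact Set.toFinite _
  have hpre : ∀ x ∈ X, ∀ b : Bool, ∃ S : 𝒮, f S = (x, b) := fun x hx b => by
    have : (x, b) ∈ Set.range f := by rw [hsurj]; exact ⟨hx, trivial⟩
    exact this
  refine ⟨fun S => if h : S ∈ 𝒮 then (f ⟨S, h⟩).1 else Classical.arbitrary α, ?_, ?_⟩
  · intro S hS
    simp only [hS, dif_pos]
    exact hft' ⟨S, hS⟩
  · intro x hx
    obtain ⟨S₁, h1⟩ := hpre x hx true
    obtain ⟨S₂, h2⟩ := hpre x hx false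
    refine ⟨S₁, S₁.2, S₂, S₂.2, ?_, by simp [h1], by simp [h2], ?_⟩
    · intro h
      have : S₁ = S₂ := Subtype.ext h
      rw [this, h2] at h1
      simp at h1
    · intro S hS hp
      simp only [hS, dif_pos] at hp
      cases hb : (f ⟨S, hS⟩).2
      · right
        have : f ⟨S, hS⟩ = f S₂ := by rw [h2]; exact Prod.ext hp hb
        exact congrArg Subtype.val (hf this)
      · left
        have : f ⟨S, hS⟩ = f S₁ := by rw [h1]; exact Prod.ext hp hb
        exact congrArg Subtype.val (hf this)

/-- Two disjoint suns can be joined by a path attached to both of them. -/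
theorem exists_join {G : SimpleGraph V} {S₁ S₂ : Set V} (h₁ : IsSun G S₁) (h₂ : IsSun G S₂)
    (hd : Disjoint S₁ S₂) {m : List V} (hm : m ≠ []) (hn : m.Nodup) (hc : m.IsChain G.Adj)
    (hm₁ : ∀ x ∈ m, x ∉ S₁) (hm₂ : ∀ x ∈ m, x ∉ S₂) (ht₁ : Touches G (m.head hm) S₁)
    (ht₂ : Touches G (m.getLast hm) S₂) :
    ∃ l₁ l₂ : List V, (l₁ ++ m ++ l₂).Nodup ∧ (l₁ ++ m ++ l₂).IsChain G.Adj ∧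
      3 ≤ (l₁ ++ m ++ l₂).length ∧ (∀ x ∈ l₁ ++ m ++ l₂, x ∈ {x | x ∈ m} ∪ S₁ ∪ S₂) ∧
      Fac G (({x | x ∈ m} ∪ S₁ ∪ S₂) \ {x | x ∈ l₁ ++ m ++ l₂}) := by
  obtain ⟨v₁, hv₁, ha₁⟩ := ht₁
  obtain ⟨v₂, hv₂, ha₂⟩ := ht₂
  obtain ⟨t₁, n₁, c₁, -, s₁, f₁⟩ := h₁.exists_lobe hv₁
  obtain ⟨t₂, n₂, c₂, -, s₂, f₂⟩ := h₂.exists_lobe hv₂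
  have hne : ∀ a ∈ v₁ :: t₁, ∀ b ∈ v₂ :: t₂, a ≠ b := fun a ha b hb hab =>
    Set.disjoint_left.1 hd (s₁ a ha) (hab ▸ s₂ b hb)
  refine ⟨(v₁ :: t₁).reverse, v₂ :: t₂, ?_, ?_, ?_, ?_, ?_⟩
  · rw [List.nodup_append, List.nodup_append]
    refine ⟨⟨List.nodup_reverse.2 n₁, hn, ?_⟩, n₂, ?_⟩
    · intro a ha b hb hab
      exact hm₁ b hb (hab ▸ s₁ a (List.mem_reverse.1 ha))
    · intro a ha b hb hab
      rcases List.mem_append.1 ha with ha | ha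
      · exact hne a (List.mem_reverse.1 ha) b hb hab
      · exact hm₂ a ha (hab ▸ s₂ b hb)
  · rw [List.isChain_append, List.isChain_append]
    refine ⟨⟨List.isChain_reverse.2 (c₁.imp fun a b h => h.symm), hc, ?_⟩, c₂, ?_⟩
    · intro x hx y hy
      rw [List.head?_eq_some_head hm] at hy
      simp at hx hy
      subst hx; subst hy
      exact ha₁.symm
    · intro x hx y hy
      rw [List.getLast?_append_of_ne_nil _ hm, List.getLast?_eq_some_getLast hm] at hx
      simp at hx hy
      subst hx; subst hy
      exact ha₂
  · have := List.length_pos_of_ne_nil hm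
    simp; omega
  · intro x hx
    simp only [List.mem_append, List.mem_reverse] at hx
    rcases hx with (hx | hx) | hx
    · exact Or.inl (Or.inr (s₁ x hx))
    · exact Or.inl (Or.inl hx)
    · exact Or.inr (s₂ x hx)
  · have : ({x | x ∈ m} ∪ S₁ ∪ S₂) \ {x | x ∈ (v₁ :: t₁).reverse ++ m ++ v₂ :: t₂} =
        (S₁ \ {x | x ∈ v₁ :: t₁}) ∪ (S₂ \ {x | x ∈ v₂ :: t₂}) := by
      ext x
      have e1 := s₁ x
      have e2 := s₂ x
      have e3 := hm₁ x
      have e4 := hm₂ x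
      have e5 : x ∈ S₁ → x ∉ S₂ := fun h => Set.disjoint_left.1 hd h
      simp only [mem_sdiff, mem_union, mem_ofPred_eq, List.mem_append, List.mem_reverse]
      tauto
    rw [this]
    exact f₁.union f₂ (hd.mono Set.sdiff_subset Set.sdiff_subset)

theorem fac_join {G : SimpleGraph V} {S₁ S₂ : Set V} (h₁ : IsSun G S₁) (h₂ : IsSun G S₂)
    (hd : Disjoint S₁ S₂) {m : List V} (hm : m ≠ []) (hn : m.Nodup) (hc : m.IsChain G.Adj)
    (hm₁ : ∀ x ∈ m, x ∉ S₁) (hm₂ : ∀ x ∈ m, x ∉ S₂) (ht₁ : Touches G (m.head hm) S₁)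
    (ht₂ : Touches G (m.getLast hm) S₂) : Fac G ({x | x ∈ m} ∪ S₁ ∪ S₂) := by
  obtain ⟨l₁, l₂, h1, h2, h3, h4, h5⟩ := exists_join h₁ h₂ hd hm hn hc hm₁ hm₂ ht₁ ht₂
  exact Fac.of_path_diff h1 h2 h3 h4 h5

/-- A sun with more than one vertex offers a lobe of at least two, so a single attached vertex
already completes a long enough path. -/
theorem fac_insert_sun {G : SimpleGraph V} {S : Set V} (h : IsSun G S) (hs : ∀ v, S ≠ {v}) {x : V}
    (hx : x ∉ S) (ht : Touches G x S) : Fac G ({x} ∪ S) := by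
  obtain ⟨v, hv, ha⟩ := ht
  obtain ⟨t, n, c, ht, s, f⟩ := h.exists_lobe hv
  have hne : t ≠ [] := fun h => hs v (ht h)
  refine Fac.of_path_diff (l := x :: v :: t) ?_ ?_ ?_ ?_ ?_
  · exact List.nodup_cons.2 ⟨fun h => hx (s x h), n⟩
  · exact List.isChain_cons_cons.2 ⟨ha, c⟩
  · have := List.length_pos_of_ne_nil hne
    simp; omega
  · intro y hy
    rcases List.mem_cons.1 hy with rfl | hy
    · exact Or.inl rfl
    · exact Or.inr (s y hy)
  · have : ({x} ∪ S) \ {y | y ∈ x :: v :: t} = S \ {y | y ∈ v :: t} := by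
      ext y
      have : y ∈ S → y ≠ x := fun h e => hx (e ▸ h)
      simp only [mem_sdiff, mem_union, mem_ofPred_eq, List.mem_cons, mem_singleton_iff]
      tauto
    rwa [this]

/-- Gluing the suns along an assignment which gives every `x` two suns. -/
theorem fac_of_assignment [Finite V] {G : SimpleGraph V} {U X : Set V} {𝒮 : Set (Set V)}
    (h𝒮 : 𝒮 ⊆ suns G U) (hX : Disjoint X U) {p : Set V → V}
    (hp : ∀ S ∈ 𝒮, p S ∈ X ∧ Touches G (p S) S)
    (hp2 : ∀ x ∈ X, ∃ S₁ ∈ 𝒮, ∃ S₂ ∈ 𝒮, S₁ ≠ S₂ ∧ p S₁ = x ∧ p S₂ = x ∧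
      ∀ S ∈ 𝒮, p S = x → S = S₁ ∨ S = S₂) {X' : Set V} (hX' : X' ⊆ X) :
    Fac G (X' ∪ ⋃₀ {S | S ∈ 𝒮 ∧ p S ∈ X'}) := by
  have hSX : ∀ S ∈ 𝒮, ∀ x ∈ X, x ∉ S := fun S hS x hx hxS =>
    Set.disjoint_left.1 hX hx ((h𝒮 hS).1.1 hxS)
  have hdis : ∀ S ∈ 𝒮, ∀ T ∈ 𝒮, S ≠ T → Disjoint S T := fun S hS T hT hne =>
    (h𝒮 hS).1.disjoint (h𝒮 hT).1 hne
  induction X', X'.toFinite using Set.Finite.induction_on with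
  | empty => simpa using Fac.empty
  | @insert x Y hx _ ih =>
    have hY : Y ⊆ X := (Set.subset_insert _ _).trans hX'
    have hxX : x ∈ X := hX' (by simp)
    obtain ⟨S₁, h1, S₂, h2, hne, e1, e2, hall⟩ := hp2 x hxX
    have hset : insert x Y ∪ ⋃₀ {S | S ∈ 𝒮 ∧ p S ∈ insert x Y} =
        ({y | y ∈ [x]} ∪ S₁ ∪ S₂) ∪ (Y ∪ ⋃₀ {S | S ∈ 𝒮 ∧ p S ∈ Y}) := by
      ext y
      simp only [mem_union, mem_insert_iff, mem_sUnion, mem_ofPred_eq, List.mem_singleton]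
      constructor
      · rintro ((rfl | h) | ⟨S, ⟨hS, hS'⟩, hy⟩)
        · tauto
        · tauto
        · rcases hS' with hS' | hS'
          · rcases hall S hS hS' with rfl | rfl <;> tauto
          · exact Or.inr (Or.inr ⟨S, ⟨hS, hS'⟩, hy⟩)
      · rintro (((rfl | h) | h) | (h | ⟨S, ⟨hS, hS'⟩, hy⟩))
        · tauto
        · exact Or.inr ⟨S₁, ⟨h1, Or.inl e1⟩, h⟩
        · exact Or.inr ⟨S₂, ⟨h2, Or.inl e2⟩, h⟩
        · tauto
        · exact Or.inr ⟨S, ⟨hS, Or.inr hS'⟩, hy⟩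
    rw [hset]
    refine Fac.union ?_ (ih hY) ?_
    · refine fac_join (h𝒮 h1).2 (h𝒮 h2).2 (hdis _ h1 _ h2 hne) (m := [x]) (by simp) (by simp)
        (by simp) ?_ ?_ ?_ ?_
      · simpa using hSX _ h1 x hxX
      · simpa using hSX _ h2 x hxX
      · simpa [e1] using (hp _ h1).2
      · simpa [e2] using (hp _ h2).2
    · rw [Set.disjoint_left]
      rintro y hy (hyY | ⟨S, ⟨hS, hS'⟩, hyS⟩)
      · rcases hy with (hy | hy) | hy
        · obtain rfl : y = x := by simpa using hy
          exact hx hyY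
        · exact hSX _ h1 y (hY hyY) hy
        · exact hSX _ h2 y (hY hyY) hy
      · rcases hy with (hy | hy) | hy
        · obtain rfl : y = x := by simpa using hy
          exact hSX S hS y hxX hyS
        · have : S ≠ S₁ := by rintro rfl; exact hx (e1 ▸ hS')
          exact Set.disjoint_left.1 (hdis _ hS _ h1 this) hyS hy
        · have : S ≠ S₂ := by rintro rfl; exact hx (e2 ▸ hS')
          exact Set.disjoint_left.1 (hdis _ hS _ h2 this) hyS hy

/-- The members of `suns G (W \ X)` all of whose neighbours in `X` lie in `T`. -/
def sunsIn (G : SimpleGraph V) (W X T : Set V) : Set (Set V) :=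
  {S | S ∈ suns G (W \ X) ∧ ∀ x ∈ X, Touches G x S → x ∈ T}

theorem sunsIn_subset {G : SimpleGraph V} {W X T : Set V} (hT : T ⊆ X) :
    sunsIn G W X T ⊆ suns G (W \ T) := by
  rintro S ⟨⟨h1, h2⟩, h3⟩
  refine ⟨h1.enlarge (Set.sdiff_subset_sdiff_right hT) fun a ha b hb hab => ?_, h2⟩
  exact ⟨hb.1, fun hbX => hb.2 (h3 b hbX ⟨a, ha, hab.symm⟩)⟩

theorem subset_sunsIn {G : SimpleGraph V} {W X : Set V} {𝒞 : Set (Set V)}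
    (h : 𝒞 ⊆ suns G (W \ X)) : 𝒞 ⊆ sunsIn G W X {x | x ∈ X ∧ ∃ S ∈ 𝒞, Touches G x S} :=
  fun S hS => ⟨h hS, fun _ hx ht => ⟨hx, S, hS, ht⟩⟩

theorem ncard_le_of_subset_sunsIn [Finite V] {G : SimpleGraph V} {W X T : Set V} (hT : T ⊆ X)
    {𝒞 : Set (Set V)} (h : 𝒞 ⊆ sunsIn G W X T) : 𝒞.ncard ≤ (suns G (W \ T)).ncard :=
  Set.ncard_le_ncard (h.trans (sunsIn_subset hT)) (Set.toFinite _)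

theorem disjoint_sUnion_of_subset {G : SimpleGraph V} {U X : Set V} {𝒞 : Set (Set V)}
    (hX : Disjoint X U) (h : ∀ C ∈ 𝒞, IsCompOn G U C) : Disjoint X (⋃₀ 𝒞) :=
  hX.mono_right (Set.sUnion_subset fun C hC => (h C hC).1)

theorem disjoint_sUnion_sUnion {G : SimpleGraph V} {U : Set V} {𝒞 𝒟 : Set (Set V)}
    (h : ∀ C ∈ 𝒞, IsCompOn G U C) (h' : ∀ C ∈ 𝒟, IsCompOn G U C) (hd : ∀ C ∈ 𝒞, C ∉ 𝒟) :
    Disjoint (⋃₀ 𝒞) (⋃₀ 𝒟) := by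
  rw [Set.disjoint_sUnion_left]
  intro C hC
  rw [Set.disjoint_sUnion_right]
  intro D hD
  exact (h C hC).disjoint (h' D hD) fun e => hd C hC (e ▸ hD)

/-- If removing `X` leaves exactly twice as many suns as allowed, then `X` together with the suns
has a path factor. -/
theorem fac_tight [Finite V] [Nonempty V] {G : SimpleGraph V} {W X : Set V} (hK : Kan G W)
    (hX : X ⊆ W) (ht : 2 * X.ncard ≤ (suns G (W \ X)).ncard) :
    Fac G (X ∪ ⋃₀ suns G (W \ X)) := by
  obtain ⟨p, hp, hp2⟩ := exists_assignment X (suns G (W \ X)) (Touches G) ht (by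
    intro 𝒞 h𝒞
    -- The suns in `𝒞` stay components when only their neighbours in `X` are deleted, so Kaneko's
    -- condition at that set is Hall's condition for `𝒞`.
    have hT : {x | x ∈ X ∧ ∃ S ∈ 𝒞, Touches G x S} ⊆ X := fun x hx => hx.1
    exact (ncard_le_of_subset_sunsIn hT (subset_sunsIn h𝒞)).trans (hK _ (hT.trans hX)))
  have := fac_of_assignment subset_rfl Set.disjoint_sdiff_right hp hp2 subset_rfl
  have hs : {S | S ∈ suns G (W \ X) ∧ p S ∈ X} = suns G (W \ X) := by
    ext S
    exact ⟨fun h => h.1, fun h => ⟨h, (hp S h).1⟩⟩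
  rwa [hs] at this

theorem eq_union_suns (G : SimpleGraph V) {W X : Set V} (hX : X ⊆ W) :
    W = X ∪ ⋃₀ suns G (W \ X) ∪ ⋃₀ {C | IsCompOn G (W \ X) C ∧ ¬ IsSun G C} := by
  have h := sUnion_isCompOn G (W \ X)
  have h2 : {C | IsCompOn G (W \ X) C} =
      suns G (W \ X) ∪ {C | IsCompOn G (W \ X) C ∧ ¬ IsSun G C} := by
    ext C
    simp only [suns, mem_union, mem_ofPred_eq]
    tauto
  rw [Set.union_assoc, ← Set.sUnion_union, ← h2, h, Set.union_sdiff_cancel hX]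

/-- Assembling a factor of `W` from the suns and the other components of `W \ X`. -/
theorem fac_union_nonsuns [Finite V] {G : SimpleGraph V} {W X : Set V} (hX : X ⊆ W)
    (h : Fac G (X ∪ ⋃₀ suns G (W \ X)))
    (hC : ∀ C, IsCompOn G (W \ X) C → ¬ IsSun G C → Fac G C) : Fac G W := by
  rw [eq_union_suns G hX]
  refine h.union (Fac.sUnion (fun C hC' => hC C hC'.1 hC'.2)
    (pairwiseDisjoint_of_isCompOn fun C hC => hC.1)) ?_
  rw [Set.disjoint_union_left]
  exact ⟨disjoint_sUnion_of_subset Set.disjoint_sdiff_right fun C hC => hC.1,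
    disjoint_sUnion_sUnion (fun C hC => hC.1) (fun C hC => hC.1) fun C hC hC' => hC'.2 hC.2⟩

/-! ### Sets with slack one -/

/-- `z` has a neighbour whose only neighbour in `W` is `z`. -/
def HasLeaf (G : SimpleGraph V) (W : Set V) (z : V) : Prop :=
  ∃ s ∈ W, G.Adj z s ∧ ∀ y ∈ W, G.Adj s y → y = z

theorem exists_touches {G : SimpleGraph V} {W X S : Set V} (hW : ConnOn G W) (hX : X ⊆ W)
    (hX0 : X.Nonempty) (hS : IsCompOn G (W \ X) S) : ∃ x ∈ X, Touches G x S := by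
  obtain ⟨z, hz⟩ := hX0
  obtain ⟨a, ha, b, hb, hbS, hab⟩ := hW.exists_adj (hS.1.trans Set.sdiff_subset) hS.2.1.1
    (fun h => (hS.1 (h ▸ hX hz)).2 hz)
  refine ⟨b, ?_, a, ha, hab.symm⟩
  by_contra hbX
  exact hbS (hS.2.2 a ha b ⟨hb, hbX⟩ hab)

theorem sunsIn_mono {G : SimpleGraph V} {W X T T' : Set V} (h : T ⊆ T') :
    sunsIn G W X T ⊆ sunsIn G W X T' :=
  fun _ hS => ⟨hS.1, fun x hx ht => h (hS.2 x hx ht)⟩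

/-- Supermodularity of the count: a sun counted for both sets is counted for their intersection, and
one counted for either set is counted for the union. -/
theorem ncard_sunsIn_add_le [Finite V] (G : SimpleGraph V) (W X T T' : Set V) :
    (sunsIn G W X T).ncard + (sunsIn G W X T').ncard ≤
      (sunsIn G W X (T ∩ T')).ncard + (sunsIn G W X (T ∪ T')).ncard := by
  rw [← Set.ncard_union_add_ncard_inter (sunsIn G W X T) (sunsIn G W X T'), add_comm]
  apply Nat.add_le_add
  · refine Set.ncard_le_ncard ?_ (Set.toFinite _)
    exact fun S hS => ⟨hS.1.1, fun x hx ht => ⟨hS.1.2 x hx ht, hS.2.2 x hx ht⟩⟩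
  · refine Set.ncard_le_ncard ?_ (Set.toFinite _)
    exact Set.union_subset (sunsIn_mono Set.subset_union_left)
      (sunsIn_mono Set.subset_union_right)

/-- Among the sets `T ∋ z` with one sun less than allowed there is a smallest one. -/
theorem exists_least_tight [Finite V] {G : SimpleGraph V} {W X : Set V}
    (hX : X ⊆ W) (hstrict : ∀ T ⊆ W, T.Nonempty → (suns G (W \ T)).ncard + 1 ≤ 2 * T.ncard)
    (ht : (suns G (W \ X)).ncard + 1 = 2 * X.ncard) {z : V} (hz : z ∈ X) :
    ∃ T₀ ⊆ X, z ∈ T₀ ∧ (sunsIn G W X T₀).ncard + 1 = 2 * T₀.ncard ∧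
      ∀ T ⊆ X, z ∈ T → (sunsIn G W X T).ncard + 1 = 2 * T.ncard → T₀ ⊆ T := by
  have hbd : ∀ T ⊆ X, T.Nonempty → (sunsIn G W X T).ncard + 1 ≤ 2 * T.ncard := fun T hT h0 =>
    (Nat.add_le_add_right (ncard_le_of_subset_sunsIn hT subset_rfl) 1).trans
      (hstrict T (hT.trans hX) h0)
  have hXX : sunsIn G W X X = suns G (W \ X) := by
    ext S; exact ⟨fun h => h.1, fun h => ⟨h, fun x hx _ => hx⟩⟩
  obtain ⟨T₀, ⟨h1, h2, h3⟩, hmin⟩ := Set.exists_min_image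
    {T | T ⊆ X ∧ z ∈ T ∧ (sunsIn G W X T).ncard + 1 = 2 * T.ncard} Set.ncard (Set.toFinite _)
    ⟨X, subset_rfl, hz, by rw [hXX, ht]⟩
  refine ⟨T₀, h1, h2, h3, fun T hT hzT hTt => ?_⟩
  have hU := hbd (T₀ ∪ T) (Set.union_subset h1 hT) ⟨z, Or.inl h2⟩
  have hI := hbd (T₀ ∩ T) (Set.inter_subset_left.trans h1) ⟨z, h2, hzT⟩
  have hc := ncard_sunsIn_add_le G W X T₀ T
  have hcc := Set.ncard_union_add_ncard_inter T₀ T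
  -- Supermodularity and the bounds at `T₀ ∪ T` and `T₀ ∩ T` force the intersection to have slack
  -- exactly one as well.
  have := hmin (T₀ ∩ T) ⟨Set.inter_subset_left.trans h1, ⟨h2, hzT⟩, by omega⟩
  have := Set.eq_of_subset_of_ncard_le (Set.inter_subset_left (s := T₀) (t := T)) this
  exact Set.inter_eq_left.1 this

/-- Setting `z` and `S₀` aside removes the slack. Hall's condition could fail only at a set of slack
one containing `z`; such a set contains `T₀`, so it loses `S₀` too. -/
theorem exists_assignment_diff [Finite V] {G : SimpleGraph V} {W X : Set V} (hW : ConnOn G W)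
    (hX : X ⊆ W) (hstrict : ∀ T ⊆ W, T.Nonempty → (suns G (W \ T)).ncard + 1 ≤ 2 * T.ncard)
    (ht : (suns G (W \ X)).ncard + 1 = 2 * X.ncard) {z : V} (hz : z ∈ X) {T₀ : Set V}
    (hleast : ∀ T ⊆ X, z ∈ T → (sunsIn G W X T).ncard + 1 = 2 * T.ncard → T₀ ⊆ T)
    {S₀ : Set V} (hS₀ : S₀ ∈ sunsIn G W X T₀) :
    ∃ p : Set V → V, (∀ S ∈ suns G (W \ X) \ {S₀}, p S ∈ X \ {z} ∧ Touches G (p S) S) ∧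
      ∀ x ∈ X \ {z}, ∃ S₁ ∈ suns G (W \ X) \ {S₀}, ∃ S₂ ∈ suns G (W \ X) \ {S₀}, S₁ ≠ S₂ ∧
        p S₁ = x ∧ p S₂ = x ∧ ∀ S ∈ suns G (W \ X) \ {S₀}, p S = x → S = S₁ ∨ S = S₂ := by
  have : Nonempty V := ⟨z⟩
  have hbd : ∀ T ⊆ X, T.Nonempty → (sunsIn G W X T).ncard + 1 ≤ 2 * T.ncard := fun T hT h0 =>
    (Nat.add_le_add_right (ncard_le_of_subset_sunsIn hT subset_rfl) 1).trans
      (hstrict T (hT.trans hX) h0)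
  apply exists_assignment
  · have h1 := Set.ncard_sdiff_singleton_add_one hz
    have h2 := Set.ncard_sdiff_singleton_add_one hS₀.1
    omega
  · intro 𝒞 h𝒞
    rcases 𝒞.eq_empty_or_nonempty with rfl | ⟨S, hS⟩
    · simp
    set T := {x | x ∈ X ∧ ∃ S ∈ 𝒞, Touches G x S} with hT
    have hTX : T ⊆ X := fun x hx => hx.1
    have hCT : 𝒞 ⊆ sunsIn G W X T := subset_sunsIn (h𝒞.trans Set.sdiff_subset)
    have hT0 : T.Nonempty := by
      obtain ⟨x, hx, hxt⟩ := exists_touches hW hX ⟨z, hz⟩ (h𝒞 hS).1.1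
      exact ⟨x, hx, S, hS, hxt⟩
    have hle := Set.ncard_le_ncard hCT (Set.toFinite _)
    have hb := hbd T hTX hT0
    have hN : {x | x ∈ X \ {z} ∧ ∃ S ∈ 𝒞, Touches G x S} = T \ {z} := by
      ext x; simp only [hT, mem_ofPred_eq, mem_sdiff]; tauto
    rw [hN]
    by_cases hzT : z ∈ T
    · have h1 := Set.ncard_sdiff_singleton_add_one hzT
      by_cases htt : (sunsIn G W X T).ncard + 1 = 2 * T.ncard
      · have hS₀T : S₀ ∈ sunsIn G W X T := sunsIn_mono (hleast T hTX hzT htt) hS₀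
        have h2 := Set.ncard_sdiff_singleton_add_one hS₀T
        have h3 : 𝒞.ncard ≤ (sunsIn G W X T \ {S₀}).ncard :=
          Set.ncard_le_ncard (fun S hS => ⟨hCT hS, (h𝒞 hS).2⟩) (Set.toFinite _)
        omega
      · omega
    · rw [Set.sdiff_singleton_eq_self hzT]
      omega

/-- If removing `X` leaves one sun less than the maximum possible number, then `W` has a path
factor or every vertex of `X` has a leaf. -/
theorem fac_or_hasLeaf [Finite V] {G : SimpleGraph V} {W X : Set V} (hW : ConnOn G W)
    (hX : X ⊆ W) (hstrict : ∀ T ⊆ W, T.Nonempty → (suns G (W \ T)).ncard + 1 ≤ 2 * T.ncard)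
    (ht : (suns G (W \ X)).ncard + 1 = 2 * X.ncard)
    (hC : ∀ C, IsCompOn G (W \ X) C → ¬ IsSun G C → Fac G C) {z : V} (hz : z ∈ X) :
    Fac G W ∨ HasLeaf G W z := by
  obtain ⟨T₀, hT₀X, hzT₀, hT₀, hleast⟩ := exists_least_tight hX hstrict ht hz
  have hdXU : Disjoint X (W \ X) := Set.disjoint_sdiff_right
  have hXS : ∀ S ∈ suns G (W \ X), ∀ x ∈ X, x ∉ S := fun S hS x hx hxS => (hS.1.1 hxS).2 hx
  have hdis : ∀ S ∈ suns G (W \ X), ∀ T ∈ suns G (W \ X), S ≠ T → Disjoint S T :=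
    fun S hS T hT hne => hS.1.disjoint hT.1 hne
  -- Here `z` is served by `S₀` alone, and every other vertex of `X` by two suns.
  have nonsingle : ∀ S₀ ∈ sunsIn G W X T₀, Touches G z S₀ → (∀ v, S₀ ≠ {v}) → Fac G W := by
    intro S₀ hS₀ hzS hns
    obtain ⟨p, hp, hp2⟩ := exists_assignment_diff hW hX hstrict ht hz hleast hS₀
    have h1 := fac_of_assignment (Set.sdiff_subset : suns G (W \ X) \ {S₀} ⊆ suns G (W \ X))
      (hdXU.mono_left Set.sdiff_subset) hp hp2 subset_rfl
    have h2 := fac_insert_sun hS₀.1.2 hns (hXS S₀ hS₀.1 z hz) hzS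
    refine fac_union_nonsuns hX ?_ hC
    have hset : X ∪ ⋃₀ suns G (W \ X) = ({z} ∪ S₀) ∪
        (X \ {z} ∪ ⋃₀ {S | S ∈ suns G (W \ X) \ {S₀} ∧ p S ∈ X \ {z}}) := by
      ext y
      simp only [mem_union, mem_sUnion, mem_singleton_iff, mem_sdiff, mem_ofPred_eq]
      constructor
      · rintro (h | ⟨S, hS, hy⟩)
        · tauto
        · by_cases hSS : S = S₀
          · subst hSS; tauto
          · exact Or.inr (Or.inr ⟨S, ⟨⟨hS, hSS⟩, (hp S ⟨hS, hSS⟩).1⟩, hy⟩)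
      · rintro ((rfl | h) | (h | ⟨S, ⟨hS, -⟩, hy⟩))
        · exact Or.inl hz
        · exact Or.inr ⟨S₀, hS₀.1, h⟩
        · exact Or.inl h.1
        · exact Or.inr ⟨S, hS.1, hy⟩
    rw [hset]
    refine h2.union h1 (Set.disjoint_left.2 ?_)
    rintro y (rfl | hy) (hy' | ⟨S, ⟨hS, -⟩, hyS⟩)
    · exact hy'.2 rfl
    · exact hXS S hS.1 y hz hyS
    · exact hXS S₀ hS₀.1 y hy'.1 hy
    · exact Set.disjoint_left.1 (hdis S hS.1 S₀ hS₀.1 hS.2) hyS hy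
  -- In this case exactly one sun has all its neighbours in `X` equal to `z`. If it is a single
  -- vertex, that vertex is a leaf at `z`.
  by_cases hTz : T₀ = {z}
  · subst hTz
    have hc : (sunsIn G W X {z}).ncard = 1 := by
      rw [Set.ncard_singleton] at hT₀; omega
    obtain ⟨S₀, hS₀⟩ := Set.ncard_eq_one.1 hc
    have hmem : S₀ ∈ sunsIn G W X {z} := by rw [hS₀]; rfl
    obtain ⟨x, hx, hxt⟩ := exists_touches hW hX ⟨z, hz⟩ hmem.1.1
    obtain rfl : x = z := hmem.2 x hx hxt
    by_cases hns : ∀ v, S₀ ≠ {v}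
    · exact Or.inl (nonsingle S₀ hmem hxt hns)
    · push Not at hns
      obtain ⟨s, rfl⟩ := hns
      right
      have hs : s ∈ W \ X := hmem.1.1.1 rfl
      obtain ⟨s', hs', ha⟩ := hxt
      obtain rfl : s' = s := hs'
      refine ⟨s', hs.1, ha, fun y hy hsy => ?_⟩
      by_cases hyX : y ∈ X
      · exact hmem.2 y hyX ⟨s', rfl, hsy.symm⟩
      · have : y = s' := hmem.1.1.2.2 s' rfl y ⟨hy, hyX⟩ hsy
        exact absurd (this ▸ hsy) (G.irrefl)
  · left
    have hT1 : (T₀ \ {z}).Nonempty := by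
      rw [Set.nonempty_iff_ne_empty, Ne, Set.sdiff_eq_empty]
      intro h
      exact hTz (h.antisymm (Set.singleton_subset_iff.2 hzT₀))
    have hb := hstrict (T₀ \ {z}) ((Set.sdiff_subset.trans hT₀X).trans hX) hT1
    have hb2 := ncard_le_of_subset_sunsIn (G := G) (W := W) (X := X)
      (Set.sdiff_subset.trans hT₀X) (subset_refl (sunsIn G W X (T₀ \ {z})))
    have hb3 := Set.ncard_sdiff_singleton_add_one hzT₀
    have hb4 := Set.le_ncard_sdiff (sunsIn G W X (T₀ \ {z})) (sunsIn G W X T₀)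
    -- `T₀` has `2|T₀| - 1` suns and `T₀ \ {z}` at most `2|T₀| - 3`, so at least two suns of `T₀`
    -- need `z`.
    have h2 : 1 < (sunsIn G W X T₀ \ sunsIn G W X (T₀ \ {z})).ncard := by omega
    obtain ⟨S₀, hS₀, S₁, hS₁, hne⟩ := (Set.one_lt_ncard (Set.toFinite _)).1 h2
    have htouch : ∀ S ∈ sunsIn G W X T₀ \ sunsIn G W X (T₀ \ {z}), Touches G z S := by
      intro S hS
      by_contra hcon
      refine hS.2 ⟨hS.1.1, fun x hx hxt => ⟨hS.1.2 x hx hxt, ?_⟩⟩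
      rintro rfl
      exact hcon hxt
    by_cases hns₀ : ∀ v, S₀ ≠ {v}
    · exact nonsingle S₀ hS₀.1 (htouch S₀ hS₀) hns₀
    by_cases hns₁ : ∀ v, S₁ ≠ {v}
    · exact nonsingle S₁ hS₁.1 (htouch S₁ hS₁) hns₁
    push Not at hns₁
    obtain ⟨s₁, rfl⟩ := hns₁
    obtain ⟨p, hp, hp2⟩ := exists_assignment_diff hW hX hstrict ht hz hleast hS₀.1
    have hmem₁ : ({s₁} : Set V) ∈ suns G (W \ X) \ {S₀} := ⟨hS₁.1.1, hne.symm⟩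
    obtain ⟨⟨hyX, hyz⟩, hyt⟩ := hp _ hmem₁
    set y := p {s₁} with hy
    obtain ⟨S₂, hS₂, hne₂, hpS₂, hall⟩ : ∃ S₂ ∈ suns G (W \ X) \ {S₀}, S₂ ≠ {s₁} ∧ p S₂ = y ∧
        ∀ S ∈ suns G (W \ X) \ {S₀}, p S = y → S = {s₁} ∨ S = S₂ := by
      obtain ⟨A, hA, B, hB, hAB, hpA, hpB, hall⟩ := hp2 y ⟨hyX, hyz⟩
      rcases hall _ hmem₁ hy.symm with h | h
      · exact ⟨B, hB, h ▸ hAB.symm, hpB, h ▸ hall⟩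
      · exact ⟨A, hA, h ▸ hAB, hpA, fun S hS hpS => h ▸ (hall S hS hpS).symm⟩
    have hs₁X : s₁ ∉ X := fun h => hXS _ hS₁.1.1 s₁ h rfl
    have hzs₁ : z ≠ s₁ := fun h => hs₁X (h ▸ hz)
    have hys₁ : s₁ ≠ y := fun h => hs₁X (h ▸ hyX)
    have hs₁S₀ : s₁ ∉ S₀ := fun h =>
      Set.disjoint_left.1 (hdis S₀ hS₀.1.1 _ hS₁.1.1 hne) h rfl
    have hs₁S₂ : s₁ ∉ S₂ := fun h => Set.disjoint_left.1 (hdis S₂ hS₂.1 _ hS₁.1.1 hne₂) h rfl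
    have hd₀₂ : Disjoint S₀ S₂ := hdis S₀ hS₀.1.1 S₂ hS₂.1 fun h => hS₂.2 h.symm
    have hzs : G.Adj z s₁ := by
      obtain ⟨s, hs, ha⟩ := htouch _ hS₁
      exact (show s = s₁ from hs) ▸ ha
    have hys : G.Adj s₁ y := by
      obtain ⟨s, hs, ha⟩ := hyt
      exact ((show s = s₁ from hs) ▸ ha).symm
    -- When the second sun is a single vertex `s₁`, it serves as a bridge: one path runs `S₀`, `z`,
    -- `s₁`, `y`, `S₂`, where `y` is the vertex to which `s₁` and `S₂` were assigned.
    have hj : Fac G ({x | x ∈ [z, s₁, y]} ∪ S₀ ∪ S₂) := by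
      refine fac_join hS₀.1.1.2 hS₂.1.2 hd₀₂ (by simp) ?_ ?_ ?_ ?_ ?_ ?_
      · simp only [List.nodup_cons, List.mem_cons, List.not_mem_nil]
        refine ⟨?_, ?_, by simp⟩
        · rintro (h | h | h)
          · exact hzs₁ h
          · exact hyz h.symm
          · exact h
        · rintro (h | h)
          · exact hys₁ h
          · exact h
      · simp [hzs, hys]
      · simp only [List.mem_cons, List.not_mem_nil, or_false]
        rintro x (rfl | rfl | rfl)
        · exact hXS S₀ hS₀.1.1 _ hz
        · exact hs₁S₀
        · exact hXS S₀ hS₀.1.1 _ hyX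
      · simp only [List.mem_cons, List.not_mem_nil, or_false]
        rintro x (rfl | rfl | rfl)
        · exact hXS S₂ hS₂.1 _ hz
        · exact hs₁S₂
        · exact hXS S₂ hS₂.1 _ hyX
      · simpa using htouch S₀ hS₀
      · simpa [hpS₂] using (hp S₂ hS₂).2
    have h1 := fac_of_assignment (Set.sdiff_subset : suns G (W \ X) \ {S₀} ⊆ suns G (W \ X))
      (hdXU.mono_left Set.sdiff_subset) hp hp2 (X' := (X \ {z}) \ {y}) Set.sdiff_subset
    refine fac_union_nonsuns hX ?_ hC
    have hset : X ∪ ⋃₀ suns G (W \ X) = ({x | x ∈ [z, s₁, y]} ∪ S₀ ∪ S₂) ∪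
        ((X \ {z}) \ {y} ∪ ⋃₀ {S | S ∈ suns G (W \ X) \ {S₀} ∧ p S ∈ (X \ {z}) \ {y}}) := by
      ext x
      simp only [mem_union, mem_sUnion, mem_singleton_iff, mem_sdiff, mem_ofPred_eq,
        List.mem_cons, List.not_mem_nil, or_false]
      constructor
      · rintro (h | ⟨S, hS, hx⟩)
        · tauto
        · by_cases hSS : S = S₀
          · subst hSS; tauto
          by_cases hpy : p S = y
          · rcases hall S ⟨hS, hSS⟩ hpy with rfl | rfl
            · have : x = s₁ := hx
              tauto
            · tauto
          · exact Or.inr (Or.inr ⟨S, ⟨⟨hS, hSS⟩, (hp S ⟨hS, hSS⟩).1, hpy⟩, hx⟩)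
      · rintro ((((rfl | rfl | rfl) | h) | h) | (h | ⟨S, ⟨hS, -⟩, hx⟩))
        · exact Or.inl hz
        · exact Or.inr ⟨_, hmem₁.1, rfl⟩
        · exact Or.inl hyX
        · exact Or.inr ⟨S₀, hS₀.1.1, h⟩
        · exact Or.inr ⟨S₂, hS₂.1, h⟩
        · exact Or.inl h.1.1
        · exact Or.inr ⟨S, hS.1, hx⟩
    rw [hset]
    refine hj.union h1 (Set.disjoint_left.2 ?_)
    simp only [mem_union, mem_sUnion, mem_singleton_iff, mem_sdiff, mem_ofPred_eq,
        List.mem_cons, List.not_mem_nil, or_false]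
    rintro x (((rfl | rfl | rfl) | hx) | hx) (hx' | ⟨S, ⟨hS, hpS⟩, hxS⟩)
    · exact hx'.1.2 rfl
    · exact hXS S hS.1 _ hz hxS
    · exact hs₁X hx'.1.1
    · have : S = {x} := by
        by_contra h
        exact Set.disjoint_left.1 (hdis S hS.1 _ hmem₁.1 h) hxS rfl
      exact hpS.2 (this ▸ hy.symm)
    · exact hx'.2 rfl
    · exact hXS S hS.1 _ hyX hxS
    · exact hXS S₀ hS₀.1.1 x hx'.1.1 hx
    · exact Set.disjoint_left.1 (hdis S hS.1 S₀ hS₀.1.1 hS.2) hxS hx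
    · exact hXS S₂ hS₂.1 x hx'.1.1 hx
    · have : S ≠ S₂ := by rintro rfl; exact hpS.2 hpS₂
      exact Set.disjoint_left.1 (hdis S hS.1 S₂ hS₂.1 this) hxS hx

/-! ### Pendant edges and the propagation of leaves -/

/-- The graph obtained from `G` by deleting all edges at `u` except the one to `v`. -/
def pend (G : SimpleGraph V) (u v : V) : SimpleGraph V where
  Adj a b := G.Adj a b ∧ (a = u → b = v) ∧ (b = u → a = v)
  symm := ⟨fun _ _ h => ⟨h.1.symm, h.2.2, h.2.1⟩⟩
  loopless := ⟨fun _ h => G.irrefl h.1⟩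

theorem pend_adj_iff {G : SimpleGraph V} {u v a b : V} (ha : a ≠ u) (hb : b ≠ u) :
    G.Adj a b ↔ (pend G u v).Adj a b :=
  ⟨fun h => ⟨h, fun e => absurd e ha, fun e => absurd e hb⟩, fun h => h.1⟩

theorem Kan.of_nonsun [Finite V] {G : SimpleGraph V} {W X C : Set V} {r : ℕ} (hX : X ⊆ W)
    (hC : IsCompOn G (W \ X) C) (hs : ¬ IsSun G C) (hr : 2 * X.ncard ≤ (suns G (W \ X)).ncard + r)
    (hK : ∀ T ⊆ W, X ⊆ T → (suns G (W \ T)).ncard + r ≤ 2 * T.ncard) : Kan G C := by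
  intro Y hY
  have h1 := ncard_suns_add_le hC hs hY
  rw [Set.sdiff_sdiff] at h1
  have h2 := hK (X ∪ Y) (Set.union_subset hX (hY.trans (hC.1.trans Set.sdiff_subset)))
    Set.subset_union_left
  have h3 := Set.ncard_union_le X Y
  omega

theorem ncard_lt_of_isCompOn [Finite V] {G : SimpleGraph V} {W X C : Set V} (hX : X ⊆ W)
    (hX0 : X.Nonempty) (hC : IsCompOn G (W \ X) C) : C.ncard < W.ncard := by
  refine Set.ncard_lt_ncard ?_ (Set.toFinite _)
  refine ⟨hC.1.trans Set.sdiff_subset, fun h => ?_⟩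
  obtain ⟨x, hx⟩ := hX0
  exact (hC.1 (h (hX hx))).2 hx

/-- Deleting `x` isolates its leaf `s`, and `{s}` is the additional sun. -/
theorem ncard_suns_sdiff_leaf [Finite V] {G : SimpleGraph V} {W : Set V} {x s : V}
    (hs : s ∈ W) (hxs : G.Adj x s) (hl : ∀ y ∈ W, G.Adj s y → y = x) (Y : Set V)
    (hY : Y ⊆ W \ {x, s}) :
    (suns G ((W \ {x, s}) \ Y)).ncard + 1 ≤ (suns G (W \ insert x Y)).ncard := by
  have hnot : ({s} : Set V) ∉ suns G ((W \ {x, s}) \ Y) := fun h =>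
    (h.1.1 (Set.mem_singleton s)).1.2 (by simp)
  rw [← Set.ncard_insert_of_notMem hnot]
  refine Set.ncard_le_ncard ?_ (Set.toFinite _)
  rintro D (rfl | hD)
  · refine ⟨⟨?_, connOn_singleton G s, ?_⟩, isSun_singleton G s⟩
    · rintro _ rfl
      refine ⟨hs, ?_⟩
      rintro (h | h)
      · exact hxs.ne h.symm
      · exact (hY h).2 (by simp)
    · rintro _ rfl b hb hsb
      exact absurd (Or.inl (hl b hb.1 hsb)) hb.2
  · refine ⟨hD.1.enlarge ?_ ?_, hD.2⟩
    · rintro y ⟨⟨h1, h2⟩, h3⟩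
      refine ⟨h1, ?_⟩
      rintro (h | h)
      · exact h2 (by simp [h])
      · exact h3 h
    · rintro a ha b ⟨hb, hb'⟩ hab
      refine ⟨⟨hb, ?_⟩, fun h => hb' (Or.inr h)⟩
      rintro (h | h)
      · exact hb' (Or.inl h)
      · obtain rfl : b = s := h
        have := hl a (hD.1.1 ha).1.1 hab.symm
        exact (hD.1.1 ha).1.2 (by simp [this])

theorem ncard_suns_sdiff_leaf_le [Finite V] {G : SimpleGraph V} {W : Set V} {x s : V} (hx : x ∈ W)
    (hs : s ∈ W) (hxs : G.Adj x s) (hl : ∀ y ∈ W, G.Adj s y → y = x)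
    (hstrict : ∀ T ⊆ W, T.Nonempty → (suns G (W \ T)).ncard + 1 ≤ 2 * T.ncard) :
    Kan G (W \ {x, s}) := by
  intro Y hY
  have h1 := ncard_suns_sdiff_leaf hs hxs hl Y hY
  have h2 := hstrict (insert x Y)
    (Set.insert_subset hx (hY.trans Set.sdiff_subset)) (Set.insert_nonempty _ _)
  have h3 := Set.ncard_insert_le x Y
  omega

/-- The aim is a path starting `s, x, z`, or failing that a structure that yields another partition
or a leaf at `z`. -/
theorem hasLeaf_step [Finite V] {G : SimpleGraph V} {W : Set V}
    (IH : ∀ (G' : SimpleGraph V) (W' : Set V), W'.ncard < W.ncard → Kan G' W' → Fac G' W')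
    (hW : ConnOn G W)
    (hstrict : ∀ T ⊆ W, T.Nonempty → (suns G (W \ T)).ncard + 1 ≤ 2 * T.ncard)
    {x s z : V} (hx : x ∈ W) (hs : s ∈ W) (hxs : G.Adj x s) (hl : ∀ y ∈ W, G.Adj s y → y = x)
    (hz : z ∈ W) (hxz : G.Adj x z) (hzs : z ≠ s) : Fac G W ∨ HasLeaf G W z := by
  have hxs' : x ≠ s := hxs.ne
  -- Under this condition induction gives a partition in which the path of `x` starts `x, z`; then
  -- `s` can be put in front.
  by_cases hK : Kan (pend G x z) (W \ {s})
  · left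
    have hf := IH _ _ (Set.ncard_sdiff_singleton_lt_of_mem hs) hK
    obtain ⟨t, hn, hc, -, hmem, hrest⟩ := hf.exists_path_of_leaf (v := x) (w := z)
      ⟨hx, hxs'⟩ (fun y _ h => h.2.1 rfl)
    refine Fac.of_path_diff (l := s :: x :: z :: t) ?_ ?_ ?_ ?_ ?_
    · exact List.nodup_cons.2 ⟨fun h => (hmem s h).2 rfl, hn⟩
    · exact List.isChain_cons_cons.2 ⟨hxs.symm, hc.imp fun a b h => h.1⟩
    · simp
    · intro y hy
      rcases List.mem_cons.1 hy with rfl | hy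
      · exact hs
      · exact (hmem y hy).1
    · have : W \ {y | y ∈ s :: x :: z :: t} = (W \ {s}) \ {y | y ∈ x :: z :: t} := by
        ext y
        simp only [mem_sdiff, mem_ofPred_eq, List.mem_cons, mem_singleton_iff]
        tauto
      rw [this]
      exact hrest.mono fun a _ b _ h => h.1
  · unfold Kan at hK
    push Not at hK
    obtain ⟨Y, hY, hlt⟩ := hK
    have hCK := ncard_suns_sdiff_leaf_le hx hs hxs hl hstrict
    set H := pend G x z with hH
    by_cases hxY : x ∈ Y
    · exfalso
      have hset : (W \ {s}) \ Y = (W \ {x, s}) \ (Y \ {x}) := by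
        ext y
        simp only [mem_sdiff, mem_singleton_iff, mem_insert_iff]
        constructor
        · rintro ⟨⟨h1, h2⟩, h3⟩
          have : y ≠ x := fun h => h3 (h ▸ hxY)
          tauto
        · tauto
      have hcg : suns H ((W \ {s}) \ Y) = suns G ((W \ {s}) \ Y) :=
        (suns_congr fun a ha b hb => pend_adj_iff (fun h => ha.2 (h ▸ hxY))
          (fun h => hb.2 (h ▸ hxY))).symm
      rw [hcg, hset] at hlt
      have h1 := hCK (Y \ {x}) (fun y hy => ⟨(hY hy.1).1, by
        rintro (h | h)
        · exact hy.2 h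
        · exact (hY hy.1).2 h⟩)
      have h2 := Set.ncard_sdiff_singleton_add_one hxY
      omega
    have hYC : Y ⊆ W \ {x, s} := fun y hy => ⟨(hY hy).1, by
      rintro (h | h)
      · exact hxY (h ▸ hy)
      · exact (hY hy).2 h⟩
    have hle := hCK Y hYC
    obtain ⟨K, hK, hxK⟩ := exists_isCompOn H (W := (W \ {s}) \ Y) (v := x) ⟨⟨hx, hxs'⟩, hxY⟩
    -- The suns other than `K` avoid `x` and are also suns of `G`, so there are at most `2|Y|` of
    -- them. The violation at `Y` therefore makes `K` a sun and `Y` tight for `W \ {x, s}`.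
    have hsub : suns H ((W \ {s}) \ Y) \ {K} ⊆ suns G ((W \ {x, s}) \ Y) := by
      rintro D ⟨⟨h1, h2⟩, h3⟩
      have hxD : x ∉ D := fun h => h3 (h1.eq_of_mem hK h hxK)
      have hne : ∀ a ∈ D, a ≠ x := fun a ha h => hxD (h ▸ ha)
      have h1' : IsCompOn H ((W \ {x, s}) \ Y) D := by
        refine h1.restrict (fun a ha => ?_) ?_
        · have := h1.1 ha
          refine ⟨⟨this.1.1, ?_⟩, this.2⟩
          rintro (h | h)
          · exact hne a ha h
          · exact this.1.2 h
        · rintro a ⟨⟨h4, h5⟩, h6⟩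
          exact ⟨⟨h4, fun h => h5 (Or.inr h)⟩, h6⟩
      refine ⟨h1'.congr fun a ha b hb => (pend_adj_iff (hne a ha) ?_).symm,
        h2.congr fun a ha b hb => (pend_adj_iff (hne a ha) (hne b hb)).symm⟩
      exact fun h => hb.1.2 (Or.inl h)
    have hcle := Set.ncard_le_ncard hsub (Set.toFinite _)
    have hKm : K ∈ suns H ((W \ {s}) \ Y) := by
      by_contra h
      rw [Set.sdiff_singleton_eq_self h] at hcle
      omega
    have hcK := Set.ncard_sdiff_singleton_add_one hKm
    have heq := Set.eq_of_subset_of_ncard_le hsub (by omega)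
    by_cases hzY : z ∈ Y
    -- Deleting `x` along with `Y` gains the sun `{s}`, so `insert x Y` has slack exactly one, and
    -- it contains `z`.
    · have h1 := ncard_suns_sdiff_leaf hs hxs hl Y hYC
      have hXW : insert x Y ⊆ W := Set.insert_subset hx (hYC.trans Set.sdiff_subset)
      have hst := hstrict _ hXW (Set.insert_nonempty _ _)
      have h3 := Set.ncard_insert_le x Y
      have hXeq : (suns G (W \ insert x Y)).ncard + 1 = 2 * (insert x Y).ncard := by omega
      refine fac_or_hasLeaf hW hXW hstrict hXeq (fun C hC hCs => ?_) (Or.inr hzY)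
      refine IH G C (ncard_lt_of_isCompOn hXW (Set.insert_nonempty _ _) hC) ?_
      exact Kan.of_nonsun hXW hC hCs hXeq.ge fun T hT hXT =>
        hstrict T hT ((Set.insert_nonempty _ _).mono hXT)
    · left
      have hzK : z ∈ K := hK.2.2 x hxK z ⟨⟨hz, hzs⟩, hzY⟩ ⟨hxz, fun _ => rfl, fun h => absurd h hxz.ne'⟩
      have : Nonempty V := ⟨x⟩
      have htight := fac_tight hCK hYC (by omega)
      have hsK : s ∉ K := fun h => (hK.1 h).1.2 rfl
      -- Since `z` lies in `K`, the lobe at `x` has at least two vertices, and `s` in front makes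
      -- three.
      have hlobe : Fac G (insert s K) := by
        obtain ⟨t, n, c, ht, sub, f⟩ := hKm.2.exists_lobe hxK
        have hne : t ≠ [] := fun h => by
          have := ht h ▸ hzK
          exact hxz.ne' this
        refine Fac.of_path_diff (l := s :: x :: t) ?_ ?_ ?_ ?_ ?_
        · exact List.nodup_cons.2 ⟨fun h => hsK (sub s h), n⟩
        · exact List.isChain_cons_cons.2 ⟨hxs.symm, c.imp fun a b h => h.1⟩
        · have := List.length_pos_of_ne_nil hne
          simp; omega
        · intro y hy
          rcases List.mem_cons.1 hy with rfl | hy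
          · exact Or.inl rfl
          · exact Or.inr (sub y hy)
        · have : insert s K \ {y | y ∈ s :: x :: t} = K \ {y | y ∈ x :: t} := by
            ext y
            have : y ∈ K → y ≠ s := fun h e => hsK (e ▸ h)
            simp only [mem_sdiff, mem_insert_iff, mem_ofPred_eq, List.mem_cons]
            tauto
          rw [this]
          exact f.mono fun a _ b _ h => h.1
      have hsunsK : ∀ S ∈ suns G ((W \ {x, s}) \ Y), Disjoint S K := by
        intro S hS
        rw [← heq] at hS
        exact hS.1.1.disjoint hK hS.2
      -- Components of `G` that meet `K` lie inside `K`, because the two graphs differ only at `x`.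
      -- Only the disjoint ones still need a partition.
      set 𝒟 := {D | (IsCompOn G ((W \ {x, s}) \ Y) D ∧ ¬ IsSun G D) ∧ Disjoint D K} with h𝒟
      have hrest : Fac G (⋃₀ 𝒟) := by
        refine Fac.sUnion (fun D hD => ?_) (pairwiseDisjoint_of_isCompOn fun D hD => hD.1.1)
        refine IH G D ?_ (Kan.of_nonsun (r := 0) hYC hD.1.1 hD.1.2 (by omega)
          fun T hT _ => hCK T hT)
        refine Set.ncard_lt_ncard ⟨hD.1.1.1.trans (Set.sdiff_subset.trans Set.sdiff_subset),
          fun h => ?_⟩ (Set.toFinite _)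
        exact (hD.1.1.1 (h hx)).1.2 (Or.inl rfl)
      have hset : W = (Y ∪ ⋃₀ suns G ((W \ {x, s}) \ Y)) ∪ ⋃₀ 𝒟 ∪ insert s K := by
        apply Set.Subset.antisymm
        · intro v hv
          by_cases hvK : v ∈ insert s K
          · exact Or.inr hvK
          left
          have hvs : v ≠ s := fun h => hvK (Or.inl h)
          have hvK' : v ∉ K := fun h => hvK (Or.inr h)
          have hvx : v ≠ x := fun h => hvK' (h ▸ hxK)
          by_cases hvY : v ∈ Y
          · exact Or.inl (Or.inl hvY)
          have hvU : v ∈ (W \ {x, s}) \ Y := ⟨⟨hv, by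
            rintro (h | h)
            · exact hvx h
            · exact hvs h⟩, hvY⟩
          obtain ⟨D, hD, hvD⟩ := exists_isCompOn G hvU
          by_cases hDs : IsSun G D
          · exact Or.inl (Or.inr ⟨D, ⟨hD, hDs⟩, hvD⟩)
          · refine Or.inr ⟨D, ⟨⟨hD, hDs⟩, ?_⟩, hvD⟩
            rw [Set.disjoint_left]
            intro w hwD hwK
            have hDK : D ∩ K = D := by
              refine hD.2.1.2 _ Set.inter_subset_left ⟨w, hwD, hwK⟩ fun a ha b hb hab => ⟨hb, ?_⟩
              have hne : ∀ c ∈ D, c ≠ x := fun c hc h => (hD.1 hc).1.2 (Or.inl h)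
              refine hK.2.2 a ha.2 b ⟨⟨(hD.1 hb).1.1, fun h => (hD.1 hb).1.2 (Or.inr h)⟩,
                (hD.1 hb).2⟩ ?_
              exact (pend_adj_iff (hne a ha.1) (hne b hb)).1 hab
            exact hvK' (Set.inter_eq_left.1 hDK hvD)
        · rintro v (((h | ⟨S, hS, hvS⟩) | ⟨D, hD, hvD⟩) | (rfl | h))
          · exact (hYC h).1
          · exact (hS.1.1 hvS).1.1
          · exact (hD.1.1.1 hvD).1.1
          · exact hs
          · exact (hK.1 h).1.1
      rw [hset]
      have hdU : Disjoint Y ((W \ {x, s}) \ Y) := Set.disjoint_sdiff_right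
      refine (htight.union hrest ?_).union hlobe ?_
      · rw [Set.disjoint_union_left]
        exact ⟨disjoint_sUnion_of_subset hdU fun C hC => hC.1.1,
          disjoint_sUnion_sUnion (fun C hC => hC.1) (fun C hC => hC.1.1)
            fun C hC hC' => hC'.1.2 hC.2⟩
      · rw [Set.disjoint_right]
        rintro v (rfl | hv) ((h | ⟨S, hS, hvS⟩) | ⟨D, hD, hvD⟩)
        · exact (hY h).2 rfl
        · exact (hS.1.1 hvS).1.2 (Or.inr rfl)
        · exact (hD.1.1.1 hvD).1.2 (Or.inr rfl)
        · exact (hK.1 hv).2 h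
        · exact Set.disjoint_left.1 (hsunsK S hS) hvS hv
        · exact Set.disjoint_left.1 hD.2 hvD hv

/-- If every allowed set of vertices leaves strictly fewer suns than permitted and there is a leaf,
then there is a path factor, or the graph is itself a sun. -/
theorem fac_of_hasLeaf [Finite V] {G : SimpleGraph V} {W : Set V}
    (IH : ∀ (G' : SimpleGraph V) (W' : Set V), W'.ncard < W.ncard → Kan G' W' → Fac G' W')
    (hW : ConnOn G W) (hns : ¬ IsSun G W)
    (hstrict : ∀ T ⊆ W, T.Nonempty → (suns G (W \ T)).ncard + 1 ≤ 2 * T.ncard)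
    {x : V} (hx : x ∈ W) (hlx : HasLeaf G W x) : Fac G W := by
  by_contra hF
  set A := {v | v ∈ W ∧ (HasLeaf G W v ∨ ∃ q ∈ W, G.Adj v q ∧ ∀ y ∈ W, G.Adj v y → y = q)}
    with hA
  -- The set of vertices that are leaves or carry a leaf is closed under adjacency, by
  -- `hasLeaf_step`, and `W` is connected.
  have hAW : A = W := by
    refine hW.2 A (fun v hv => hv.1) ⟨x, hx, Or.inl hlx⟩ ?_
    rintro a ⟨haW, ha⟩ b hb hab
    rcases ha with ⟨s, hs, has, hl⟩ | ⟨q, hq, haq, hl⟩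
    · by_cases hbs : b = s
      · exact ⟨hb, Or.inr ⟨a, haW, hab.symm, fun y hy h => hl y hy (hbs ▸ h)⟩⟩
      · exact ⟨hb, Or.inl ((hasLeaf_step IH hW hstrict haW hs has hl hb hab hbs).resolve_left hF)⟩
    · obtain rfl := hl b hb hab
      exact ⟨hb, Or.inl ⟨a, haW, haq.symm, hl⟩⟩
  have hfac : ∀ v ∈ W, ∀ s ∈ W, G.Adj v s → (∀ y ∈ W, G.Adj s y → y = v) →
      Fac G (W \ {v, s}) := by
    intro v hv s hs hvs hl
    refine IH G _ ?_ (ncard_suns_sdiff_leaf_le hv hs hvs hl hstrict)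
    refine Set.ncard_lt_ncard ⟨Set.sdiff_subset, fun h => ?_⟩ (Set.toFinite _)
    exact (h hv).2 (Or.inl rfl)
  refine hns ⟨hW, Or.inr fun v hv => ?_⟩
  rw [← hAW] at hv
  obtain ⟨hvW, ⟨s, hs, hvs, hl⟩ | ⟨q, hq, hvq, hl⟩⟩ := hv
  · exact ⟨s, hs, hvs, Or.inr hl, hfac v hvW s hs hvs hl⟩
  · refine ⟨q, hq, hvq, Or.inl hl, ?_⟩
    rw [Set.pair_comm]
    exact hfac q hq v hvW hvq.symm hl

/-! ### Suns after deleting an edge -/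

theorem deleteEdges_adj_iff {G : SimpleGraph V} {x y a b : V} (h : ¬ s(a, b) = s(x, y)) :
    G.Adj a b ↔ (G.deleteEdges {s(x, y)}).Adj a b := by
  simp [SimpleGraph.deleteEdges_adj, h]

theorem sym2_ne_of_left {x y a b : V} (h : a ≠ x) (h' : a ≠ y) : ¬ s(a, b) = s(x, y) := by
  intro e
  rcases Sym2.eq_iff.1 e with h1 | h1
  · exact h h1.1
  · exact h' h1.1

theorem ncard_isCompOn_mem_le_one [Finite V] {G : SimpleGraph V} {U : Set V} (x : V)
    {𝒞 : Set (Set V)} (h : ∀ C ∈ 𝒞, IsCompOn G U C ∧ x ∈ C) : 𝒞.ncard ≤ 1 :=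
  (Set.ncard_le_one (Set.toFinite _)).2 fun C hC D hD =>
    (h C hC).1.eq_of_mem (h D hD).1 (h C hC).2 (h D hD).2

/-- A component containing neither end of the edge is unchanged, and each end lies in only one
component. -/
theorem ncard_suns_deleteEdges_le [Finite V] (G : SimpleGraph V) (x y : V) (U : Set V) :
    (suns (G.deleteEdges {s(x, y)}) U).ncard ≤ (suns G U).ncard + 2 := by
  set G' := G.deleteEdges {s(x, y)}
  have hsub : suns G' U ⊆ suns G U ∪ ({C | C ∈ suns G' U ∧ x ∈ C} ∪ {C | C ∈ suns G' U ∧ y ∈ C}) := by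
    intro C hC
    by_cases hx : x ∈ C
    · exact Or.inr (Or.inl ⟨hC, hx⟩)
    by_cases hy : y ∈ C
    · exact Or.inr (Or.inr ⟨hC, hy⟩)
    have hadj : ∀ a ∈ C, ∀ b, G'.Adj a b ↔ G.Adj a b := by
      intro a ha b
      have hax : a ≠ x := fun h => hx (h ▸ ha)
      have hay : a ≠ y := fun h => hy (h ▸ ha)
      exact (deleteEdges_adj_iff (sym2_ne_of_left hax hay)).symm
    exact Or.inl ⟨hC.1.congr fun a ha b _ => hadj a ha b, hC.2.congr fun a ha b _ => hadj a ha b⟩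
  have h1 := Set.ncard_le_ncard hsub (Set.toFinite _)
  have h2 := Set.ncard_union_le (suns G U)
    ({C | C ∈ suns G' U ∧ x ∈ C} ∪ {C | C ∈ suns G' U ∧ y ∈ C})
  have h3 := Set.ncard_union_le {C | C ∈ suns G' U ∧ x ∈ C} {C | C ∈ suns G' U ∧ y ∈ C}
  have h4 := ncard_isCompOn_mem_le_one x (𝒞 := {C | C ∈ suns G' U ∧ x ∈ C})
    fun C hC => ⟨hC.1.1, hC.2⟩
  have h5 := ncard_isCompOn_mem_le_one y (𝒞 := {C | C ∈ suns G' U ∧ y ∈ C})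
    fun C hC => ⟨hC.1.1, hC.2⟩
  omega

/-- Deleting an edge of a connected graph without leaves creates no sun component. -/
theorem suns_deleteEdges_eq_empty [Finite V] {G : SimpleGraph V} {W : Set V} (hW : ConnOn G W)
    (hnl : ∀ v ∈ W, ¬ HasLeaf G W v) {x y : V} (hx : x ∈ W) (hy : y ∈ W) (hxy : G.Adj x y) :
    suns (G.deleteEdges {s(x, y)}) W = ∅ := by
  set G' := G.deleteEdges {s(x, y)} with hG'
  rw [Set.eq_empty_iff_forall_notMem]
  rintro S ⟨hS, -, hsun⟩
  have hle : ∀ a b, G'.Adj a b → G.Adj a b := fun a b h => (SimpleGraph.deleteEdges_adj.1 h).1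
  have hnxy : ¬ G'.Adj x y := by simp [hG', SimpleGraph.deleteEdges_adj]
  rcases hsun with ⟨v, rfl⟩ | hsun
  · have hv : v ∈ W := hS.1 rfl
    have hiso : ∀ b ∈ W, ¬ G'.Adj v b := fun b hb h => by
      have : b = v := hS.2.2 v rfl b hb h
      exact G'.irrefl (this ▸ h)
    by_cases hvx : v = x
    · subst hvx
      refine hnl y hy ⟨v, hx, hxy.symm, fun w hw h => ?_⟩
      by_contra hwy
      refine hiso w hw ((deleteEdges_adj_iff ?_).1 h)
      rw [Sym2.congr_right]; exact hwy
    by_cases hvy : v = y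
    · subst hvy
      refine hnl x hx ⟨v, hy, hxy, fun w hw h => ?_⟩
      by_contra hwy
      refine hiso w hw ((deleteEdges_adj_iff ?_).1 h)
      rw [Sym2.eq_swap (a := x), Sym2.congr_right]; exact hwy
    · have := hW.2 {v} (Set.singleton_subset_iff.2 hv) (Set.singleton_nonempty v) (by
        rintro _ rfl b hb h
        exact absurd ((deleteEdges_adj_iff (sym2_ne_of_left hvx hvy)).1 h) (hiso b hb))
      exact hvx ((this ▸ hx : x ∈ ({v} : Set V)).symm)
  -- A leaf of `S` away from the deleted edge would already be a leaf in `G`. So every leaf of `S`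
  -- is an end of that edge.
  · have claim : ∀ l ∈ S, ∀ q ∈ S, G'.Adj l q → (∀ w ∈ S, G'.Adj l w → w = q) → l = x ∨ l = y := by
      intro l hl q hq hlq huniq
      by_contra hcon
      push Not at hcon
      refine hnl q (hS.1 hq) ⟨l, hS.1 hl, (hle _ _ hlq).symm, fun w hw h => ?_⟩
      have h' := (deleteEdges_adj_iff (sym2_ne_of_left hcon.1 hcon.2)).1 h
      exact huniq w (hS.2.2 l hl w hw h') h'
    have pairs : ∀ v ∈ S, ∃ l ∈ S, ∃ q ∈ S, G'.Adj l q ∧ (∀ w ∈ S, G'.Adj l w → w = q) ∧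
        (v = l ∨ v = q) ∧ (l = x ∨ l = y) ∧ Fac G' (S \ {l, q}) := by
      intro v hv
      obtain ⟨w, hw, hvw, h | h, hf⟩ := hsun v hv
      · exact ⟨v, hv, w, hw, hvw, h, Or.inl rfl, claim v hv w hw hvw h, hf⟩
      · exact ⟨w, hw, v, hv, hvw.symm, h, Or.inr rfl, claim w hw v hv hvw.symm h,
          Set.pair_comm v w ▸ hf⟩
    obtain ⟨v, hv⟩ := hS.2.1.1
    obtain ⟨l, hl, q, hq, hlq, hu, -, hlxy, hf⟩ := pairs v hv
    rcases (S \ {l, q}).eq_empty_or_nonempty with he | hne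
    · have hsub : S ⊆ {l, q} := Set.sdiff_eq_empty.1 he
      have hq' := claim q hq l hl hlq.symm fun w hw h => by
        rcases hsub hw with h' | h'
        · exact h'
        · exact absurd ((show w = q from h') ▸ h) G'.irrefl
      rcases hlxy with rfl | rfl <;> rcases hq' with rfl | rfl
      · exact G'.irrefl hlq
      · exact hnxy hlq
      · exact hnxy hlq.symm
      · exact G'.irrefl hlq
    -- Each of these three vertices lies in a pair whose leaf is the end of the deleted edge other
    -- than `l`. That is a single pair, with room for only two of them.
    · obtain ⟨a, ha, b, hb, c, hc, hab, hac, hbc⟩ := hf.three_le hne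
      have other : ∀ d ∈ S \ {l, q}, ∃ l' q', (l' = x ∨ l' = y) ∧ l' ≠ l ∧ (d = l' ∨ d = q') ∧
          l' ∈ S ∧ q' ∈ S ∧ G'.Adj l' q' ∧ (∀ w ∈ S, G'.Adj l' w → w = q') := by
        rintro d ⟨hd, hd'⟩
        obtain ⟨l', hl', q', hq', h1, h2, h3, h4, -⟩ := pairs d hd
        refine ⟨l', q', h4, ?_, h3, hl', hq', h1, h2⟩
        rintro rfl
        rw [hu q' hq' h1] at h3
        exact hd' h3
      obtain ⟨la, qa, h1, h2, h3, h4, h5, h6, h7⟩ := other a ha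
      obtain ⟨lb, qb, g1, g2, g3, g4, g5, g6, g7⟩ := other b hb
      obtain ⟨lc, qc, f1, f2, f3, f4, f5, f6, f7⟩ := other c hc
      have e1 : lb = la := by grind
      have e2 : lc = la := by grind
      subst e1; subst e2
      have e3 := g7 qa h5 h6
      have e4 := g7 qc f5 f6
      subst e3; subst e4
      grind

/-! ### The double induction -/

/-- **Kaneko's theorem**, sufficiency. -/
theorem fac_of_kan [Finite V] {G : SimpleGraph V} {W : Set V} (hK : Kan G W) : Fac G W := by
  obtain ⟨n, hn⟩ : ∃ n, W.ncard = n := ⟨_, rfl⟩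
  induction n using Nat.strong_induction_on generalizing G W with
  | _ n ihn =>
  have IH : ∀ (G' : SimpleGraph V) (W' : Set V), W'.ncard < W.ncard → Kan G' W' → Fac G' W' :=
    fun G' W' h hK' => ihn _ (hn ▸ h) hK' rfl
  clear ihn
  obtain ⟨m, hm⟩ : ∃ m, G.edgeSet.ncard = m := ⟨_, rfl⟩
  induction m using Nat.strong_induction_on generalizing G with
  | _ m ihm =>
  have tight : ∀ X ⊆ W, 2 * X.ncard ≤ (suns G (W \ X)).ncard → W.Nonempty →
      (∀ C, IsCompOn G (W \ X) C → ¬ IsSun G C → C.ncard < W.ncard) → Fac G W := by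
    rintro X hX hc ⟨w, -⟩ hlt
    have : Nonempty V := ⟨w⟩
    refine fac_union_nonsuns hX (fac_tight hK hX hc) fun C hC hCs => ?_
    exact IH G C (hlt C hC hCs) (Kan.of_nonsun (r := 0) hX hC hCs hc fun T hT _ => hK T hT)
  rcases W.eq_empty_or_nonempty with rfl | hW0
  · exact Fac.empty
  by_cases hW : ConnOn G W
  swap
  -- In a disconnected `W` the empty set is tight, and all components are smaller.
  · refine tight ∅ (Set.empty_subset _) (by simp) hW0 fun C hC _ => ?_
    rw [Set.sdiff_empty] at hC
    refine Set.ncard_lt_ncard (hC.1.ssubset_of_ne ?_) (Set.toFinite _)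
    rintro rfl
    exact hW hC.2.1
  have hns : ¬ IsSun G W := fun h => by
    have h0 := hK ∅ (Set.empty_subset _)
    rw [Set.sdiff_empty, Set.ncard_empty, mul_zero, Nat.le_zero,
      Set.ncard_eq_zero (Set.toFinite _)] at h0
    exact Set.notMem_empty W (h0 ▸ (⟨hW.isCompOn, h⟩ : W ∈ suns G W))
  by_cases hstrict : ∀ T ⊆ W, T.Nonempty → (suns G (W \ T)).ncard + 1 ≤ 2 * T.ncard
  swap
  · push Not at hstrict
    obtain ⟨X, hX, hX0, hc⟩ := hstrict
    exact tight X hX (by omega) hW0 fun C hC _ => ncard_lt_of_isCompOn hX hX0 hC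
  by_cases hleaf : ∃ x ∈ W, HasLeaf G W x
  · obtain ⟨x, hx, hlx⟩ := hleaf
    exact fac_of_hasLeaf IH hW hns hstrict hx hlx
  push Not at hleaf
  by_cases hstrict2 : ∀ T ⊆ W, T.Nonempty → (suns G (W \ T)).ncard + 2 ≤ 2 * T.ncard
  swap
  · push Not at hstrict2
    obtain ⟨X, hX, ⟨z, hz⟩, hc⟩ := hstrict2
    have h1 := hstrict X hX ⟨z, hz⟩
    have heq : (suns G (W \ X)).ncard + 1 = 2 * X.ncard := by omega
    refine (fac_or_hasLeaf hW hX hstrict heq (fun C hC hCs => ?_) hz).resolve_right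
      (hleaf z (hX hz))
    refine IH G C (ncard_lt_of_isCompOn hX ⟨z, hz⟩ hC) ?_
    exact Kan.of_nonsun hX hC hCs heq.ge fun T hT hXT => hstrict T hT ⟨z, hXT hz⟩
  -- With slack two and no leaf, any edge may go: at most two suns appear for nonempty `X`, and none
  -- for `X = ∅`.
  obtain ⟨x, hx⟩ := hW0
  obtain ⟨x', rfl, y, hy, -, hxy⟩ := hW.exists_adj (A := {x}) (by simpa using hx) (by simp)
    (fun h => hns (h ▸ isSun_singleton G x))
  have hfac := ihm _ ?_ (G := G.deleteEdges {s(x', y)}) ?_ rfl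
  · exact hfac.mono fun a _ b _ h => (SimpleGraph.deleteEdges_adj.1 h).1
  · rw [← hm]
    refine Set.ncard_lt_ncard ?_ (Set.toFinite _)
    rw [SimpleGraph.edgeSet_deleteEdges]
    refine ⟨Set.sdiff_subset, fun h => ?_⟩
    exact (h (show s(x', y) ∈ G.edgeSet from hxy)).2 rfl
  · intro X hX
    rcases X.eq_empty_or_nonempty with rfl | hX0
    · rw [Set.sdiff_empty, suns_deleteEdges_eq_empty hW hleaf hx hy hxy]
      simp
    · exact (ncard_suns_deleteEdges_le G x' y _).trans (hstrict2 X hX hX0)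

/-! ### From path partitions to path factors -/

/-- `a` and `b` are consecutive in `l`. -/
def Consec (l : List V) (a b : V) : Prop :=
  ∃ i, ∃ h : i + 1 < l.length, l[i] = a ∧ l[i + 1] = b

/-- The path along the list `l`. -/
def pathOf (l : List V) : SimpleGraph V where
  Adj a b := a ≠ b ∧ (Consec l a b ∨ Consec l b a)
  symm := ⟨fun _ _ h => ⟨h.1.symm, h.2.symm⟩⟩
  loopless := ⟨fun _ h => h.1 rfl⟩

theorem pathOf_le {G : SimpleGraph V} {l : List V} (hc : l.IsChain G.Adj) : pathOf l ≤ G := by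
  rintro a b ⟨-, ⟨i, hi, rfl, rfl⟩ | ⟨i, hi, rfl, rfl⟩⟩
  · exact List.isChain_iff_getElem.1 hc i hi
  · exact (List.isChain_iff_getElem.1 hc i hi).symm

theorem mem_of_pathOf_adj {l : List V} {a b : V} (h : (pathOf l).Adj a b) : a ∈ l := by
  rcases h.2 with ⟨i, hi, rfl, rfl⟩ | ⟨i, hi, rfl, rfl⟩ <;> exact List.getElem_mem _

theorem pathOf_adj_getElem {l : List V} (hn : l.Nodup) {i j : ℕ} (hi : i < l.length)
    (hj : j < l.length) : (pathOf l).Adj l[i] l[j] ↔ i + 1 = j ∨ j + 1 = i := by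
  constructor
  · rintro ⟨-, ⟨k, hk, h1, h2⟩ | ⟨k, hk, h1, h2⟩⟩
    · rw [hn.getElem_inj_iff] at h1 h2; omega
    · rw [hn.getElem_inj_iff] at h1 h2; omega
  · rintro (rfl | rfl)
    · exact ⟨by rw [Ne, hn.getElem_inj_iff]; omega, Or.inl ⟨i, hj, rfl, rfl⟩⟩
    · exact ⟨by rw [Ne, hn.getElem_inj_iff]; omega, Or.inr ⟨j, hi, rfl, rfl⟩⟩

/-- `H` is, on `W`, a disjoint union of paths with at least three vertices. -/
def IsPathUnion (H : SimpleGraph V) (W : Set V) : Prop :=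
  (∀ a b, H.Adj a b → a ∈ W) ∧ ∀ v ∈ W, ∃ l : List V, l.Nodup ∧ 3 ≤ l.length ∧ v ∈ l ∧
    (∀ x ∈ l, x ∈ W) ∧ ∀ a ∈ l, ∀ b, H.Adj a b ↔ (pathOf l).Adj a b

theorem IsPathUnion.sup_pathOf {H : SimpleGraph V} {W : Set V} {l : List V}
    (h : IsPathUnion H W) (hn : l.Nodup) (hl : 3 ≤ l.length) (hd : ∀ x ∈ l, x ∉ W) :
    IsPathUnion (H ⊔ pathOf l) ({x | x ∈ l} ∪ W) := by
  refine ⟨?_, ?_⟩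
  · rintro a b (hab | hab)
    · exact Or.inr (h.1 a b hab)
    · exact Or.inl (mem_of_pathOf_adj hab)
  · rintro v (hv | hv)
    · refine ⟨l, hn, hl, hv, fun x hx => Or.inl hx, fun a ha b => ?_⟩
      rw [SimpleGraph.sup_adj]
      exact or_iff_right fun hab => hd a ha (h.1 a b hab)
    · obtain ⟨m, mn, ml, vm, mW, hm⟩ := h.2 v hv
      refine ⟨m, mn, ml, vm, fun x hx => Or.inr (mW x hx), fun a ha b => ?_⟩
      rw [SimpleGraph.sup_adj, hm a ha b]
      exact or_iff_left fun hab => hd a (mem_of_pathOf_adj hab) (mW a ha)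

theorem Fac.exists_isPathUnion {G : SimpleGraph V} {W : Set V} (h : Fac G W) :
    ∃ H ≤ G, IsPathUnion H W := by
  induction h with
  | empty => exact ⟨⊥, bot_le, fun a b h => h.elim, fun v hv => hv.elim⟩
  | @cons l W hn hc hl hd h ih =>
    obtain ⟨H, hH, hp⟩ := ih
    exact ⟨H ⊔ pathOf l, sup_le hH (pathOf_le hc), hp.sup_pathOf hn hl hd⟩

theorem IsPathUnion.exists_iso {H : SimpleGraph V} (h : IsPathUnion H Set.univ)
    (C : H.ConnectedComponent) :
    ∃ m : ℕ, 3 ≤ m ∧ Nonempty (C.toSimpleGraph ≃g SimpleGraph.pathGraph m) := by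
  induction C using SimpleGraph.ConnectedComponent.ind with
  | _ v =>
  obtain ⟨l, hn, hl, hv, -, hadj⟩ := h.2 v trivial
  have hreach0 : ∀ i (hi : i < l.length), H.Reachable (l[0]'(by omega)) l[i] := by
    intro i
    induction i with
    | zero => intro _; exact SimpleGraph.Reachable.refl _
    | succ i ih =>
      intro hi
      refine (ih (by omega)).trans (SimpleGraph.Adj.reachable ?_)
      rw [hadj _ (List.getElem_mem _), pathOf_adj_getElem hn]
      exact Or.inl rfl
  have hmem : ∀ x, x ∈ (H.connectedComponentMk v).supp ↔ x ∈ l := by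
    intro x
    rw [SimpleGraph.ConnectedComponent.mem_supp_iff, SimpleGraph.ConnectedComponent.eq]
    constructor
    · intro hx
      obtain ⟨w⟩ := hx.symm
      clear hreach0
      induction w with
      | nil => exact hv
      | cons hab _ ih =>
        rename_i a b c _
        have hb : b ∈ l := mem_of_pathOf_adj ((hadj a hv b).1 hab).symm
        exact ih hb ((SimpleGraph.Adj.reachable hab).symm.trans hx.symm).symm
    · intro hx
      obtain ⟨i, hi, rfl⟩ := List.getElem_of_mem hx
      obtain ⟨j, hj, rfl⟩ := List.getElem_of_mem hv
      exact (hreach0 i hi).symm.trans (hreach0 j hj)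
  refine ⟨l.length, hl, ⟨SimpleGraph.Iso.symm ?_⟩⟩
  refine ⟨Equiv.ofBijective (fun i : Fin l.length =>
    (⟨l[i], (hmem _).2 (List.getElem_mem _)⟩ : (H.connectedComponentMk v).supp)) ⟨?_, ?_⟩, ?_⟩
  · intro i j hij
    have : l[i.1] = l[j.1] := congrArg Subtype.val hij
    exact Fin.ext (hn.getElem_inj_iff.1 this)
  · rintro ⟨x, hx⟩
    obtain ⟨i, hi, rfl⟩ := List.getElem_of_mem ((hmem x).1 hx)
    exact ⟨⟨i, hi⟩, rfl⟩
  · intro i j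
    rw [SimpleGraph.pathGraph_adj]
    change H.Adj l[i.1] l[j.1] ↔ _
    rw [hadj _ (List.getElem_mem _), pathOf_adj_getElem hn]

/-- `Fac` does not record which edges its paths use, so the path through `uv` is kept apart from the
partition of the rest. -/
theorem exists_isPathFactor {G : SimpleGraph V} {l₁ l₂ : List V} {u v : V}
    (hn : (l₁ ++ [u, v] ++ l₂).Nodup) (hc : (l₁ ++ [u, v] ++ l₂).IsChain G.Adj)
    (hl : 3 ≤ (l₁ ++ [u, v] ++ l₂).length)
    (h : Fac G (Set.univ \ {x | x ∈ l₁ ++ [u, v] ++ l₂})) :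
    ∃ H : SimpleGraph V, SimpleGraph.IsPathFactor 3 G H ∧ H.Adj u v := by
  obtain ⟨H, hH, hp⟩ := h.exists_isPathUnion
  have hp' := hp.sup_pathOf hn hl (fun x hx hx' => hx'.2 hx)
  rw [Set.union_sdiff_cancel (Set.subset_univ _)] at hp'
  refine ⟨_, ⟨sup_le hH (pathOf_le hc), hp'.exists_iso⟩, Or.inr ⟨?_, Or.inl ?_⟩⟩
  · rintro rfl
    simp [List.nodup_append] at hn
  · exact ⟨l₁.length, by simp, by simp, by simp⟩

/-! ### Counting components under edge deletions -/

theorem connOn_of_connected {G : SimpleGraph V} {U : Set V} (h : (G.induce U).Connected) :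
    ConnOn G U := by
  obtain ⟨⟨u, hu⟩⟩ := h.nonempty
  refine ⟨⟨u, hu⟩, fun A hA ⟨a, ha⟩ hcl => hA.antisymm fun b hb => ?_⟩
  have key : ∀ x y : U, (G.induce U).Walk x y → x.1 ∈ A → y.1 ∈ A := by
    intro x y w
    induction w with
    | nil => exact id
    | cons hab _ ih => exact fun hx => ih (hcl _ hx _ (Subtype.coe_prop _) hab)
  obtain ⟨w⟩ := h.preconnected ⟨a, hA ha⟩ ⟨b, hb⟩
  exact key _ _ w ha

theorem ConnOn.ncard_comps {G : SimpleGraph V} {U : Set V} (h : ConnOn G U) :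
    {C | IsCompOn G U C}.ncard = 1 := by
  rw [Set.ncard_eq_one]
  exact ⟨U, Set.ext fun C => ⟨fun hC => h.eq_of_isCompOn hC, fun hC => hC ▸ h.isCompOn⟩⟩

theorem ncard_suns_le_comps [Finite V] (G : SimpleGraph V) (U : Set V) :
    (suns G U).ncard ≤ {C | IsCompOn G U C}.ncard :=
  Set.ncard_le_ncard (fun _ hC => hC.1) (Set.toFinite _)

/-- At most two new components arise, those of the ends, and the old component of `x` disappears. -/
theorem ncard_comps_deleteEdges_le [Finite V] (G : SimpleGraph V) (x y : V) (U : Set V) :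
    {C | IsCompOn (G.deleteEdges {s(x, y)}) U C}.ncard ≤ {C | IsCompOn G U C}.ncard + 1 := by
  set G' := G.deleteEdges {s(x, y)}
  by_cases hxU : x ∈ U
  · obtain ⟨K, hK, hxK⟩ := exists_isCompOn G hxU
    have hsub : {C | IsCompOn G' U C} ⊆ ({C | IsCompOn G U C} \ {K}) ∪
        ({C | IsCompOn G' U C ∧ x ∈ C} ∪ {C | IsCompOn G' U C ∧ y ∈ C}) := by
      intro C hC
      by_cases hx : x ∈ C
      · exact Or.inr (Or.inl ⟨hC, hx⟩)
      by_cases hy : y ∈ C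
      · exact Or.inr (Or.inr ⟨hC, hy⟩)
      have hadj : ∀ a ∈ C, ∀ b, G'.Adj a b ↔ G.Adj a b := by
        intro a ha b
        have hax : a ≠ x := fun h => hx (h ▸ ha)
        have hay : a ≠ y := fun h => hy (h ▸ ha)
        exact (deleteEdges_adj_iff (sym2_ne_of_left hax hay)).symm
      exact Or.inl ⟨hC.congr fun a ha b _ => hadj a ha b, fun h => hx (h ▸ hxK)⟩
    have h1 := Set.ncard_le_ncard hsub (Set.toFinite _)
    have h2 := Set.ncard_union_le ({C | IsCompOn G U C} \ {K})
      ({C | IsCompOn G' U C ∧ x ∈ C} ∪ {C | IsCompOn G' U C ∧ y ∈ C})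
    have h3 := Set.ncard_union_le {C | IsCompOn G' U C ∧ x ∈ C} {C | IsCompOn G' U C ∧ y ∈ C}
    have h4 := ncard_isCompOn_mem_le_one x (𝒞 := {C | IsCompOn G' U C ∧ x ∈ C}) fun C hC => hC
    have h5 := ncard_isCompOn_mem_le_one y (𝒞 := {C | IsCompOn G' U C ∧ y ∈ C}) fun C hC => hC
    have h6 := Set.ncard_sdiff_singleton_add_one (show K ∈ {C | IsCompOn G U C} from hK)
    omega
  · have hadj : ∀ a ∈ U, ∀ b ∈ U, G'.Adj a b ↔ G.Adj a b := by
      intro a ha b hb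
      refine (deleteEdges_adj_iff fun e => ?_).symm
      rcases Sym2.eq_iff.1 e with h1 | h1
      · exact hxU (h1.1 ▸ ha)
      · exact hxU (h1.2 ▸ hb)
    refine (Set.ncard_le_ncard (fun C hC => ?_) (Set.toFinite _)).trans (Nat.le_succ _)
    exact IsCompOn.congr (fun a ha b hb => hadj a (hC.1 ha) b hb) hC

theorem comps_pend_of_notMem {G : SimpleGraph V} {u v : V} {U : Set V} (hu : u ∉ U) :
    {C | IsCompOn (pend G u v) U C} = {C | IsCompOn G U C} := by
  have hadj : ∀ a ∈ U, ∀ b ∈ U, G.Adj a b ↔ (pend G u v).Adj a b := fun a ha b hb =>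
    pend_adj_iff (fun h => hu (h ▸ ha)) (fun h => hu (h ▸ hb))
  ext C
  exact ⟨fun hC => IsCompOn.congr (fun a ha b hb => (hadj a (hC.1 ha) b hb).symm) hC,
    fun hC => IsCompOn.congr (fun a ha b hb => hadj a (hC.1 ha) b hb) hC⟩

theorem isCompOn_of_pend {G : SimpleGraph V} {u v : V} {U D : Set V}
    (hD : IsCompOn (pend G u v) U D) (hu : u ∉ D) : IsCompOn G (U \ {u}) D := by
  have hne : ∀ a ∈ D, a ≠ u := fun a ha h => hu (h ▸ ha)
  have := hD.restrict (U := U \ {u}) (fun a ha => ⟨hD.1 ha, hne a ha⟩) Set.sdiff_subset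
  exact this.congr fun a ha b hb => (pend_adj_iff (hne a ha) hb.2).symm

/-- With `v` absent, `u` becomes isolated and costs one extra component. -/
theorem comps_pend_subset {G : SimpleGraph V} {u v : V} {U : Set V} (hu : u ∈ U) (hv : v ∉ U) :
    {C | IsCompOn (pend G u v) U C} ⊆ insert {u} {C | IsCompOn G (U \ {u}) C} := by
  intro D hD
  by_cases huD : u ∈ D
  · left
    refine IsCompOn.eq_of_mem hD ⟨Set.singleton_subset_iff.2 hu, connOn_singleton _ u, ?_⟩ huD rfl
    rintro _ rfl b hb hab
    exact absurd (hab.2.1 rfl ▸ hb) hv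
  · exact Or.inr (isCompOn_of_pend hD huD)

/-- With `v` present, `u` merely hangs on `v`. Removing it neither empties nor splits a component,
so `D ↦ D \ {u}` is an injection. -/
theorem ncard_comps_pend_le [Finite V] {G : SimpleGraph V} {u v : V} {U : Set V}
    (hv : v ∈ U) (huv : G.Adj u v) :
    {C | IsCompOn (pend G u v) U C}.ncard ≤ {C | IsCompOn G (U \ {u}) C}.ncard := by
  have hvu : v ≠ u := huv.ne'
  refine Set.ncard_le_ncard_of_injOn (fun D => D \ {u}) ?_ ?_ (Set.toFinite _)
  · intro D hD
    by_cases huD : u ∈ D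
    swap
    · rw [Set.sdiff_singleton_eq_self huD]
      exact isCompOn_of_pend hD huD
    have hvD : v ∈ D := hD.2.2 u huD v hv ⟨huv, fun _ => rfl, fun h => absurd h hvu⟩
    refine ⟨Set.sdiff_subset_sdiff_left hD.1, ⟨⟨v, hvD, hvu⟩, fun A hA hA0 hcl => ?_⟩, ?_⟩
    · by_cases hvA : v ∈ A
      · have := hD.2.1.2 (insert u A) (Set.insert_subset huD (hA.trans Set.sdiff_subset))
          (Set.insert_nonempty _ _) ?_
        · rw [← this, Set.insert_sdiff_of_mem _ (Set.mem_singleton u)]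
          exact (Set.sdiff_singleton_eq_self fun h => (hA h).2 rfl).symm
        · rintro a (rfl | ha) b hb hab
          · exact Or.inr (hab.2.1 rfl ▸ hvA)
          · by_cases hbu : b = u
            · exact Or.inl hbu
            · exact Or.inr (hcl a ha b ⟨hb, hbu⟩ hab.1)
      · have := hD.2.1.2 A (hA.trans Set.sdiff_subset) hA0 ?_
        · exact absurd rfl (hA (this ▸ huD)).2
        · intro a ha b hb hab
          refine hcl a ha b ⟨hb, fun h => ?_⟩ hab.1
          exact hvA (hab.2.2 h ▸ ha)
    · rintro a ⟨ha, hau⟩ b ⟨hb, hbu⟩ hab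
      exact ⟨hD.2.2 a ha b hb ((pend_adj_iff hau hbu).1 hab), hbu⟩
  · intro D hD E hE h
    have hmem : ∀ D, IsCompOn (pend G u v) U D → ∃ w ∈ D, w ≠ u := by
      intro D hD
      obtain ⟨w, hw⟩ := hD.2.1.1
      by_cases hwu : w = u
      · subst hwu
        exact ⟨v, hD.2.2 w hw v hv ⟨huv, fun _ => rfl, fun h => absurd h hvu⟩, hvu⟩
      · exact ⟨w, hw, hwu⟩
    obtain ⟨w, hw, hwu⟩ := hmem D hD
    have hwE : w ∈ E \ {u} := by
      have : w ∈ D \ {u} := ⟨hw, hwu⟩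
      have h' : D \ {u} = E \ {u} := h
      rwa [h'] at this
    exact IsCompOn.eq_of_mem hD hE hw hwE.1

/-! Choosing one vertex from each of the smallest components -/

/-- Dropping an element of largest value repeatedly never raises the average. -/
theorem exists_subset_sum_le {ι : Type*} [DecidableEq ι] (s : Finset ι) (f : ι → ℕ) {m : ℕ}
    (hm : m ≤ s.card) :
    ∃ t ⊆ s, t.card = m ∧ s.card * ∑ i ∈ t, f i ≤ m * ∑ i ∈ s, f i := by
  induction hm using Nat.decreasingInduction with
  | self => exact ⟨s, subset_rfl, rfl, le_rfl⟩
  | of_succ m hm ih =>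
    obtain ⟨t, hts, htc, hle⟩ := ih
    have ht0 : t.Nonempty := Finset.card_pos.1 (by omega)
    obtain ⟨i, hi, hmax⟩ := Finset.exists_max_image t f ht0
    refine ⟨t.erase i, (Finset.erase_subset _ _).trans hts, ?_, ?_⟩
    · rw [Finset.card_erase_of_mem hi]; omega
    · have h1 := Finset.sum_erase_add t f hi
      have h2 : ∑ j ∈ t, f j ≤ (m + 1) * f i := by
        have := Finset.sum_le_card_nsmul t f (f i) hmax
        rwa [htc, smul_eq_mul] at this
      have h3 : (m + 1) * ∑ j ∈ t.erase i, f j ≤ m * ∑ j ∈ t, f j := by nlinarith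
      have h4 : (m + 1) * (s.card * ∑ j ∈ t.erase i, f j) ≤ (m + 1) * (m * ∑ j ∈ s, f j) := by
        calc (m + 1) * (s.card * ∑ j ∈ t.erase i, f j)
            = s.card * ((m + 1) * ∑ j ∈ t.erase i, f j) := by ring
          _ ≤ s.card * (m * ∑ j ∈ t, f j) := Nat.mul_le_mul_left _ h3
          _ = m * (s.card * ∑ j ∈ t, f j) := by ring
          _ ≤ m * ((m + 1) * ∑ j ∈ s, f j) := Nat.mul_le_mul_left _ hle
          _ = (m + 1) * (m * ∑ j ∈ s, f j) := by ring
      exact Nat.le_of_mul_le_mul_left h4 (Nat.succ_pos m)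

theorem ncard_sUnion_finset [Finite V] (s : Finset (Set V))
    (hd : (s : Set (Set V)).PairwiseDisjoint id) : (⋃₀ (s : Set (Set V))).ncard = ∑ C ∈ s, C.ncard := by
  classical
  induction s using Finset.induction_on with
  | empty => simp
  | insert C s hC ih =>
    rw [Finset.coe_insert, Set.sUnion_insert, Set.ncard_union_eq, Finset.sum_insert hC, ih]
    · exact hd.subset (by simp)
    · rw [Set.disjoint_sUnion_right]
      intro D hD
      exact hd (by simp) (by simp [Finset.mem_coe.1 hD]) (fun h => hC (h ▸ hD))

/-- If `G - X` has at least `a` components, then some independent set of size `a` has all its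
neighbours in `X` and in `a` components which are small on average. -/
theorem exists_indep_of_comps [Finite V] [Nonempty V] (G : SimpleGraph V) (X : Set V) {a : ℕ}
    (ha : a ≤ {C | IsCompOn G Xᶜ C}.ncard) :
    ∃ (A : Set V) (σ : ℕ), G.IsIndepSet A ∧ A.ncard = a ∧ (G.nbhd A).ncard + a ≤ X.ncard + σ ∧
      {C | IsCompOn G Xᶜ C}.ncard * σ ≤ a * Xᶜ.ncard ∧
      {C | IsCompOn G Xᶜ C}.ncard ≤ Xᶜ.ncard := by
  classical
  set 𝒞 := {C | IsCompOn G Xᶜ C} with h𝒞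
  set s := (Set.toFinite 𝒞).toFinset with hs
  have hscoe : (s : Set (Set V)) = 𝒞 := Set.Finite.coe_toFinset _
  have hsc : s.card = 𝒞.ncard := (Set.ncard_eq_toFinset_card 𝒞 _).symm
  have hms : ∀ C, C ∈ s ↔ IsCompOn G Xᶜ C := fun C => Set.Finite.mem_toFinset _
  have hd : (s : Set (Set V)).PairwiseDisjoint id :=
    pairwiseDisjoint_of_isCompOn fun C hC => (hms C).1 hC
  have hsum : ∑ C ∈ s, C.ncard = Xᶜ.ncard := by
    rw [← ncard_sUnion_finset s hd, hscoe, h𝒞, sUnion_isCompOn]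
  obtain ⟨t, hts, htc, hle⟩ := exists_subset_sum_le s Set.ncard (hsc ▸ ha)
  have hr : ∀ C ∈ t, C.Nonempty := fun C hC => ((hms C).1 (hts hC)).2.1.1
  choose! r hr using hr
  have hinj : Set.InjOn r (t : Set (Set V)) := fun C hC D hD h =>
    ((hms C).1 (hts hC)).eq_of_mem ((hms D).1 (hts hD)) (hr C hC) (h ▸ hr D hD)
  have htd : (t : Set (Set V)).PairwiseDisjoint id := hd.subset (by exact_mod_cast hts)
  have hAc : (r '' (t : Set (Set V))).ncard = a := by
    rw [hinj.ncard_image, Set.ncard_coe_finset, htc]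
  have hnb : ∀ C ∈ t, ∀ w, G.Adj (r C) w → w ∉ X → w ∈ C := fun C hC w hw hwX =>
    ((hms C).1 (hts hC)).2.2 (r C) (hr C hC) w hwX hw
  have hindep : G.IsIndepSet (r '' (t : Set (Set V))) := by
    rintro _ ⟨C, hC, rfl⟩ _ ⟨D, hD, rfl⟩ hne hadj
    have hDX : r D ∉ X := ((hms D).1 (hts hD)).1 (hr D hD)
    have := ((hms C).1 (hts hC)).eq_of_mem ((hms D).1 (hts hD)) (hnb C hC _ hadj hDX) (hr D hD)
    exact hne (this ▸ rfl)
  refine ⟨r '' (t : Set (Set V)), ∑ C ∈ t, C.ncard, hindep, hAc, ?_, ?_, ?_⟩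
  · have hsub : G.nbhd (r '' (t : Set (Set V))) ⊆
        X ∪ (⋃₀ (t : Set (Set V)) \ (r '' (t : Set (Set V)))) := by
      intro w hw
      simp only [SimpleGraph.nbhd, Set.mem_iUnion] at hw
      obtain ⟨_, ⟨C, hC, rfl⟩, hadj⟩ := hw
      by_cases hwX : w ∈ X
      · exact Or.inl hwX
      refine Or.inr ⟨⟨C, hC, hnb C hC w hadj hwX⟩, fun hwA => ?_⟩
      exact hindep ⟨C, hC, rfl⟩ hwA (G.ne_of_adj hadj) hadj
    have h1 := Set.ncard_le_ncard hsub (Set.toFinite _)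
    have h2 := Set.ncard_union_le X (⋃₀ (t : Set (Set V)) \ (r '' (t : Set (Set V))))
    have hAsub : r '' (t : Set (Set V)) ⊆ ⋃₀ (t : Set (Set V)) := by
      rintro _ ⟨C, hC, rfl⟩
      exact ⟨C, hC, hr C hC⟩
    have h3 := Set.ncard_sdiff_add_ncard_of_subset hAsub
    rw [ncard_sUnion_finset t htd, hAc] at h3
    omega
  · rw [← hsc, ← hsum]; exact hle
  · rw [← hsum, ← hsc, Finset.card_eq_sum_ones]
    refine Finset.sum_le_sum fun C hC => ?_
    exact (Set.ncard_pos (Set.toFinite _)).2 ((hms C).1 hC).2.1.1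

/-- The arithmetic behind the neighbourhood condition. -/
theorem nbhd_arith {γ k x n c a σ N : ℝ} (hγ : 1 / 3 ≤ γ) (hx : k + 2 ≤ x)
    (hk : 0 ≤ k) (ha : a ≤ γ * (2 * k + 1)) (hc : 2 * x - 3 ≤ c) (hcr : c ≤ n - x)
    (hσ : c * σ ≤ a * (n - x)) (hN : N + a ≤ x + σ) :
    N ≤ γ * (n - 3 * k - 2) + k + 2 := by
  by_contra hcon
  push Not at hcon
  -- Nonnegative excesses replace the variables: `y` over `|X| = k + 2`, `d` over `c = 2x - 3`, and
  -- `r` is the number of vertices outside `X`.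
  obtain ⟨y, rfl⟩ : ∃ y, x = y + k + 2 := ⟨x - k - 2, by ring⟩
  obtain ⟨r, rfl⟩ : ∃ r, n = r + (y + k + 2) := ⟨n - (y + k + 2), by ring⟩
  obtain ⟨d, rfl⟩ : ∃ d, c = 2 * y + 2 * k + 1 + d := ⟨c - (2 * y + 2 * k + 1), by ring⟩
  have hy : 0 ≤ y := by linarith
  have hd : 0 ≤ d := by linarith
  have hcpos : 0 < 2 * y + 2 * k + 1 + d := by linarith
  set c := 2 * y + 2 * k + 1 + d with hcdef
  have hrc : 0 ≤ r - c := by linarith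
  have h1 : c * (σ - a) ≤ γ * (2 * k + 1) * (r - c) := by
    have : a * (r - c) ≤ γ * (2 * k + 1) * (r - c) := mul_le_mul_of_nonneg_right ha hrc
    nlinarith
  have h2 : γ * (y - 2 * k + r) < y + (σ - a) := by nlinarith
  have h3 : c * (γ * (y - 2 * k + r)) < c * y + γ * (2 * k + 1) * (r - c) := by
    have := mul_lt_mul_of_pos_left h2 hcpos
    linarith
  have h4 : γ * (c * (y + 1) + r * (2 * y + d)) < c * y := by
    have : c * (γ * (y - 2 * k + r)) - γ * (2 * k + 1) * (r - c) =
        γ * (c * (y + 1) + r * (2 * y + d)) := by rw [hcdef]; ring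
    linarith
  -- As `r ≥ c`, the left side of `h4` is at least `γ c (3y + 1)`. With `γ ≥ 1/3` this exceeds `c
  -- y`, a contradiction.
  have h5 : c * (2 * y) ≤ r * (2 * y + d) := by
    have e1 : c * (2 * y) ≤ r * (2 * y) := mul_le_mul_of_nonneg_right (by linarith) (by linarith)
    have e2 : 0 ≤ r * d := mul_nonneg (by linarith) hd
    linarith
  have h6 : (1 / 3) * (c * (y + 1) + c * (2 * y)) ≤ γ * (c * (y + 1) + r * (2 * y + d)) := by
    apply mul_le_mul hγ (by linarith) _ (by linarith)
    have := mul_nonneg hcpos.le hy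
    linarith
  nlinarith

/-- With `|X| ≥ k + 2`, failure means at least `2|X| - 3 ≥ 2k + 1` components. As `γ ≤ 1`, these
suffice to choose an independent set of the prescribed size. -/
theorem ncard_comps_le_of_nbhd [Finite V] {G : SimpleGraph V} {k : ℕ} {γ : ℝ} (hγ : 1 / 3 ≤ γ)
    (hγ' : γ ≤ 1)
    (h : ∀ A : Set V, G.IsIndepSet A → A.ncard = ⌊γ * (2 * (k : ℝ) + 1)⌋₊ →
      ((G.nbhd A).ncard : ℝ) > γ * ((Nat.card V : ℝ) - 3 * (k : ℝ) - 2) + (k : ℝ) + 2)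
    {X : Set V} (hX : k + 2 ≤ X.ncard) : {C | IsCompOn G Xᶜ C}.ncard + 4 ≤ 2 * X.ncard := by
  by_contra hcon
  push Not at hcon
  have hk0 : (0 : ℝ) ≤ k := Nat.cast_nonneg k
  have hpos : 0 ≤ γ * (2 * (k : ℝ) + 1) := mul_nonneg (by linarith) (by linarith)
  have hfl := Nat.floor_le hpos
  have : Nonempty V := by
    obtain ⟨x, -⟩ := Set.nonempty_of_ncard_ne_zero (s := X) (by omega)
    exact ⟨x⟩
  have ha : ⌊γ * (2 * (k : ℝ) + 1)⌋₊ ≤ 2 * k + 1 := by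
    apply Nat.floor_le_of_le
    push_cast
    nlinarith
  obtain ⟨A, σ, hA, hAc, hN, hσ, hc⟩ := exists_indep_of_comps G X
    (a := ⌊γ * (2 * (k : ℝ) + 1)⌋₊) (by omega)
  have hgt := h A hA hAc
  have hcompl := Set.ncard_add_ncard_compl X
  set c := {C | IsCompOn G Xᶜ C}.ncard
  have hcompl' : (Xᶜ.ncard : ℝ) = (Nat.card V : ℝ) - X.ncard := by
    rw [← hcompl]; push_cast; ring
  have := nbhd_arith (γ := γ) (k := k) (x := X.ncard) (n := Nat.card V) (c := c)
    (a := (⌊γ * (2 * (k : ℝ) + 1)⌋₊ : ℝ)) (σ := σ) (N := (G.nbhd A).ncard) hγ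
    (by exact_mod_cast hX) hk0 hfl (by
      have : 2 * X.ncard ≤ c + 3 := by omega
      have : (2 * X.ncard : ℝ) ≤ c + 3 := by exact_mod_cast this
      linarith) (by rw [← hcompl']; exact_mod_cast hc)
    (by rw [← hcompl']; exact_mod_cast hσ) (by exact_mod_cast hN)
  linarith

/-! ### Connectivity after deletion and covering a given edge -/

/-- Deleting an edge lowers the connectivity by at most one. -/
theorem connOn_deleteEdges [Finite V] {G : SimpleGraph V} {k : ℕ} (hcard : k + 2 ≤ Nat.card V)
    (hG : ∀ X : Set V, X.ncard < k + 1 → ConnOn G Xᶜ) {p q : V} {X : Set V} (hX : X.ncard < k) :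
    ConnOn (G.deleteEdges {s(p, q)}) Xᶜ := by
  have hcompl := Set.ncard_add_ncard_compl X
  refine ⟨(hG X (by omega)).1, fun A hA hA0 hcl => ?_⟩
  by_contra hne
  obtain ⟨a, ha, b, hb, hbA, hab⟩ := (hG X (by omega)).exists_adj hA hA0 hne
  have cross : ∀ a' ∈ A, ∀ b' ∈ Xᶜ, b' ∉ A → G.Adj a' b' → s(a', b') = s(p, q) := by
    intro a' ha' b' hb' hbA' hab'
    by_contra h
    exact hbA' (hcl a' ha' b' hb' ((deleteEdges_adj_iff h).1 hab'))
  have hpq := cross a ha b hb hbA hab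
  have uniq : ∀ a' ∈ A, ∀ b' ∈ Xᶜ, b' ∉ A → G.Adj a' b' → a' = a ∧ b' = b := by
    intro a' ha' b' hb' hbA' hab'
    have h := (cross a' ha' b' hb' hbA' hab').trans hpq.symm
    rcases Sym2.eq_iff.1 h with h | h
    · exact h
    · exact absurd (h.1 ▸ ha') hbA
  -- The edge `ab` is the only one across the cut. If `A` has another vertex, deleting `a`
  -- disconnects the graph. Otherwise deleting `b` does, unless only `a` and `b` lie outside `X`,
  -- which the order forbids.
  by_cases hAa : A = {a}
  · have hXb := hG (insert b X) ((Set.ncard_insert_le b X).trans_lt (by omega))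
    have h1 : A = (insert b X)ᶜ := by
      refine hXb.2 A ?_ hA0 fun a' ha' b' hb' hab' => ?_
      · rintro y hy (rfl | h)
        · exact hbA hy
        · exact hA hy h
      · by_contra hbA'
        have hb'X : b' ∈ Xᶜ := fun h => hb' (Or.inr h)
        exact hb' (Or.inl (uniq a' ha' b' hb'X hbA' hab').2)
    have h2 : Xᶜ ⊆ {a, b} := by
      intro y hy
      by_cases hyb : y = b
      · exact Or.inr hyb
      · left
        have : y ∈ A := by
          rw [h1]
          rintro (h | h)
          · exact hyb h
          · exact hy h
        rwa [hAa] at this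
    have h3 := Set.ncard_le_ncard h2 (Set.toFinite _)
    have h4 := Set.ncard_insert_le a ({b} : Set V)
    rw [Set.ncard_singleton] at h4
    omega
  · have hXa := hG (insert a X) ((Set.ncard_insert_le a X).trans_lt (by omega))
    have hA1 : (A \ {a}).Nonempty := by
      rw [Set.nonempty_iff_ne_empty, Ne, Set.sdiff_eq_empty]
      intro h
      exact hAa (h.antisymm (Set.singleton_subset_iff.2 ha))
    have h1 := hXa.2 (A \ {a}) ?_ hA1 ?_
    · have hba : b ∈ (insert a X)ᶜ := by
        rintro (h | h)
        · exact hbA (h ▸ ha)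
        · exact hb h
      rw [← h1] at hba
      exact hbA hba.1
    · rintro y ⟨hy, hya⟩ (h | h)
      · exact hya h
      · exact hA hy h
    · rintro a' ⟨ha', haa'⟩ b' hb' hab'
      have hb'X : b' ∈ Xᶜ := fun h => hb' (Or.inr h)
      refine ⟨?_, fun h => hb' (Or.inl h)⟩
      by_contra hbA'
      exact haa' (uniq a' ha' b' hb'X hbA' hab').1

/-- A path factor through `uv` when deleting all other edges at `u` leaves a sun. -/
theorem exists_isPathFactor_of_isSun [Finite V] {G : SimpleGraph V} {u v : V} (huv : G.Adj u v)
    (hcard : 3 ≤ Nat.card V) (hdeg : ∀ x : V, ConnOn G {x}ᶜ)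
    (hsun : IsSun (pend G u v) Set.univ) :
    ∃ H : SimpleGraph V, SimpleGraph.IsPathFactor 3 G H ∧ H.Adj u v := by
  have hvu := huv.ne'
  have huv' : (pend G u v).Adj u v := ⟨huv, fun _ => rfl, fun h => absurd h hvu⟩
  have hleafu : ∀ y, (pend G u v).Adj u y → y = v := fun y h => h.2.1 rfl
  have huniv : ({u, v} : Set V) ≠ Set.univ := by
    intro h
    have h1 := Set.ncard_pair huv.ne
    rw [h, Set.ncard_univ] at h1
    omega
  obtain ⟨a, ha, b, -, hbA, hab⟩ := hsun.1.exists_adj (Set.subset_univ {u, v}) (by simp) huniv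
  have hbu : b ≠ u := fun h => hbA (Or.inl h)
  have hbv : b ≠ v := fun h => hbA (Or.inr h)
  have hvb : (pend G u v).Adj v b := by
    rcases ha with rfl | ha
    · exact absurd (hleafu b hab) hbv
    · exact (show a = v from ha) ▸ hab
  rcases hsun.2 with ⟨x, hx⟩ | hsun2
  · have h1 : Nat.card V = 1 := by rw [← Set.ncard_univ, hx, Set.ncard_singleton]
    omega
  obtain ⟨w, -, hbw, hleaf, hf⟩ := hsun2 b trivial
  have hwu : w ≠ u := by
    rintro rfl
    exact hbv (hleafu b hbw.symm)
  have huW : u ∈ Set.univ \ ({b, w} : Set V) := ⟨trivial, by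
    rintro (h | h)
    · exact hbu h.symm
    · exact hwu h.symm⟩
  obtain ⟨t, tn, tc, t0, tW, hrest⟩ := hf.exists_path_of_leaf huW fun y _ h => hleafu y h
  have hwv : w ≠ v := by
    rintro rfl
    exact (tW w (by simp)).2 (Or.inr rfl)
  have hwleaf : ∀ y, (pend G u v).Adj w y → y = b := by
    rcases hleaf with h | h
    · exact absurd (h v trivial hvb.symm).symm hwv
    · exact fun y => h y trivial
  -- In `pend` the vertex `w` is a leaf at `b`, but `G - b` is connected. Its further neighbour in
  -- `G` can only be `u`, so the path may begin `b, w, u, v`.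
  have hwu' : G.Adj w u := by
    have hwb : w ∈ ({b} : Set V)ᶜ := hbw.ne'
    obtain ⟨w', rfl, c, hc, -, hwc⟩ := (hdeg b).exists_adj (A := {w})
      (Set.singleton_subset_iff.2 hwb) (Set.singleton_nonempty w) (by
        intro h
        have : u ∈ ({w} : Set V) := by rw [h]; exact hbu.symm
        exact hwu (show u = w from this).symm)
    by_cases hcu : c = u
    · exact hcu ▸ hwc
    · exact absurd (hwleaf c ((pend_adj_iff hwu hcu).1 hwc)) hc
  have hnot : ∀ x ∈ u :: v :: t, x ≠ b ∧ x ≠ w := fun x hx =>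
    ⟨fun h => (tW x hx).2 (Or.inl h), fun h => (tW x hx).2 (Or.inr h)⟩
  have hl : [b, w] ++ [u, v] ++ t = b :: w :: u :: v :: t := by simp
  refine exists_isPathFactor (l₁ := [b, w]) (l₂ := t) ?_ ?_ ?_ ?_
  · rw [hl]
    refine List.nodup_cons.2 ⟨fun h => ?_, List.nodup_cons.2 ⟨fun h => (hnot w h).2 rfl, tn⟩⟩
    rcases List.mem_cons.1 h with h | h
    · exact hbw.ne h
    · exact (hnot b h).1 rfl
  · rw [hl]
    exact List.isChain_cons_cons.2 ⟨hbw.1, List.isChain_cons_cons.2 ⟨hwu', tc.imp fun a b h => h.1⟩⟩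
  · rw [hl]; simp
  · have : Set.univ \ {x | x ∈ [b, w] ++ [u, v] ++ t} =
        (Set.univ \ {b, w}) \ {x | x ∈ u :: v :: t} := by
      ext x
      simp only [hl, mem_sdiff, mem_ofPred_eq, List.mem_cons, mem_insert_iff, mem_singleton_iff]
      tauto
    rw [this]
    exact hrest.mono fun a _ b _ h => h.1

/-- A path factor through `uv` when `G - {u, v}` consists of two suns. -/
theorem exists_isPathFactor_of_two_suns [Finite V] {G : SimpleGraph V} {u v : V} (huv : G.Adj u v)
    (hdeg : ∀ x : V, ConnOn G {x}ᶜ) (hc : {C | IsCompOn G ({u, v} : Set V)ᶜ C}.ncard ≤ 2)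
    (hs : 3 ≤ (suns (pend G u v) ({v} : Set V)ᶜ).ncard) :
    ∃ H : SimpleGraph V, SimpleGraph.IsPathFactor 3 G H ∧ H.Adj u v := by
  have hUu : ({v} : Set V)ᶜ \ {u} = ({u, v} : Set V)ᶜ := by
    ext x; simp only [mem_sdiff, mem_compl_iff, mem_singleton_iff, mem_insert_iff]; tauto
  have hsub : suns (pend G u v) ({v} : Set V)ᶜ \ {{u}} ⊆ suns G ({u, v} : Set V)ᶜ := by
    rintro D ⟨⟨h1, h2⟩, h3⟩
    have hD : IsCompOn G ({u, v} : Set V)ᶜ D := by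
      have := comps_pend_subset (U := ({v} : Set V)ᶜ) (show u ∈ ({v} : Set V)ᶜ from huv.ne)
        (fun h => h rfl) h1
      rw [hUu] at this
      exact this.resolve_left h3
    have hne : ∀ a ∈ D, a ≠ u := fun a ha h => hD.1 ha (Or.inl h)
    exact ⟨hD, h2.congr fun a ha b hb => (pend_adj_iff (hne a ha) (hne b hb)).symm⟩
  have h2 := Set.le_ncard_sdiff {{u}} (suns (pend G u v) ({v} : Set V)ᶜ)
  rw [Set.ncard_singleton] at h2
  have h1 : 1 < (suns (pend G u v) ({v} : Set V)ᶜ \ {{u}}).ncard := by omega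
  obtain ⟨P, hP, Q, hQ, hne⟩ := (Set.one_lt_ncard (Set.toFinite _)).1 h1
  replace hP := hsub hP
  replace hQ := hsub hQ
  -- Of the three suns at most one is `{u}`. The other two exhaust the components of `G - {u, v}`,
  -- of which there are at most two.
  have hcomps : ({P, Q} : Set (Set V)) = {C | IsCompOn G ({u, v} : Set V)ᶜ C} := by
    refine Set.eq_of_subset_of_ncard_le ?_ (by rw [Set.ncard_pair hne]; exact hc) (Set.toFinite _)
    rintro C (rfl | rfl)
    · exact hP.1
    · exact hQ.1
  have hcover : ∀ x, x ≠ u → x ≠ v → x ∈ P ∨ x ∈ Q := by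
    intro x hxu hxv
    have hx : x ∈ ({u, v} : Set V)ᶜ := by
      rintro (h | h)
      · exact hxu h
      · exact hxv h
    obtain ⟨C, hC, hxC⟩ := exists_isCompOn G hx
    have : C ∈ ({P, Q} : Set (Set V)) := hcomps ▸ hC
    rcases this with rfl | rfl
    · exact Or.inl hxC
    · exact Or.inr hxC
  have htouch : ∀ R ∈ suns G ({u, v} : Set V)ᶜ, ∀ x y : V, ({x, y} : Set V) = {u, v} → x ≠ y →
      Touches G x R := by
    intro R hR x y hxy hxy'
    have hRy : R ⊆ ({y} : Set V)ᶜ := fun a ha h => hR.1.1 ha (hxy ▸ Or.inr h)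
    obtain ⟨a, ha, b, hb, hbR, hab⟩ := (hdeg y).exists_adj hRy hR.1.2.1.1 (by
      rintro h
      exact hR.1.1 (h ▸ hxy' : x ∈ R) (hxy ▸ Or.inl rfl))
    by_cases hbx : b = x
    · exact ⟨a, ha, hbx ▸ hab.symm⟩
    · refine absurd (hR.1.2.2 a ha b ?_ hab) hbR
      rw [← hxy]
      rintro (h | h)
      · exact hbx h
      · exact hb h
  have hnotin : ∀ R ∈ suns G ({u, v} : Set V)ᶜ, ∀ x ∈ [u, v], x ∉ R := by
    intro R hR x hx hxR
    have := hR.1.1 hxR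
    simp at hx
    exact this hx
  obtain ⟨l₁, l₂, n, c, len, -, hf⟩ := exists_join hP.2 hQ.2 (hP.1.disjoint hQ.1 hne)
    (m := [u, v]) (by simp) (by simp [huv.ne]) (by simp [huv]) (hnotin P hP) (hnotin Q hQ)
    (by simpa using htouch P hP u v rfl huv.ne)
    (by simpa using htouch Q hQ v u (Set.pair_comm v u) huv.ne')
  refine exists_isPathFactor n c len ?_
  have : ({x | x ∈ [u, v]} ∪ P ∪ Q) = (Set.univ : Set V) := by
    rw [Set.eq_univ_iff_forall]
    intro x
    have := hcover x
    simp only [mem_union, mem_ofPred_eq, List.mem_cons, List.not_mem_nil, or_false]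
    tauto
  rwa [this] at hf

/-- A graph in which every set of vertices leaves few components is a path factor covered graph. -/
theorem isPathFactorCovered_of_comps [Finite V] {G : SimpleGraph V} {k : ℕ} (hk : 1 ≤ k)
    (hcard : k + 3 ≤ Nat.card V)
    (hbig : ∀ X : Set V, k + 2 ≤ X.ncard → {C | IsCompOn G Xᶜ C}.ncard + 3 ≤ 2 * X.ncard)
    (hmid : ∀ X : Set V, X.ncard ≤ k + 1 → {C | IsCompOn G Xᶜ C}.ncard ≤ 2)
    (hsmall : ∀ X : Set V, X.ncard ≤ k → ConnOn G Xᶜ) :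
    G.IsPathFactorCovered 3 := by
  intro e he
  induction e using Sym2.ind with
  | _ u v =>
  have huv : G.Adj u v := he
  have hdeg : ∀ x : V, ConnOn G {x}ᶜ := fun x => hsmall {x} (by rw [Set.ncard_singleton]; exact hk)
  suffices h : ∃ H : SimpleGraph V, SimpleGraph.IsPathFactor 3 G H ∧ H.Adj u v from h
  by_cases hsun : IsSun (pend G u v) Set.univ
  · exact exists_isPathFactor_of_isSun huv (by omega) hdeg hsun
  by_cases htwo : 3 ≤ (suns (pend G u v) ({v} : Set V)ᶜ).ncard
  · refine exists_isPathFactor_of_two_suns huv hdeg (hmid _ ?_) htwo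
    rw [Set.ncard_pair huv.ne]; omega
  have hK : Kan (pend G u v) Set.univ := by
    intro X _
    rw [← Set.compl_eq_univ_sdiff]
    have hle := ncard_suns_le_comps (pend G u v) Xᶜ
    by_cases huX : u ∈ X
    · rw [comps_pend_of_notMem (U := Xᶜ) (fun h => h huX)] at hle
      have hpos : 0 < X.ncard := (Set.ncard_pos (Set.toFinite _)).2 ⟨u, huX⟩
      rcases le_or_gt (k + 2) X.ncard with hb | hb
      · have := hbig X hb; omega
      · have := hmid X (by omega); omega
    have hins : Xᶜ \ {u} = (insert u X)ᶜ := by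
      ext x; simp only [mem_sdiff, mem_compl_iff, mem_singleton_iff, mem_insert_iff]; tauto
    have hcu := Set.ncard_insert_of_notMem huX (Set.toFinite _)
    by_cases hvX : v ∈ X
    · have hpos : 0 < X.ncard := (Set.ncard_pos (Set.toFinite _)).2 ⟨v, hvX⟩
      rcases Nat.lt_or_ge 1 X.ncard with h1 | h1
      · have hsub := Set.ncard_le_ncard (comps_pend_subset (G := G) (u := u) (v := v)
          (U := Xᶜ) huX (fun h => h hvX)) (Set.toFinite _)
        have hin := Set.ncard_insert_le {u} {C | IsCompOn G (Xᶜ \ {u}) C}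
        rw [hins] at hsub hin
        rcases le_or_gt (k + 2) (insert u X).ncard with hb | hb
        · have := hbig _ hb; omega
        · have := hmid (insert u X) (by omega); omega
      · have hX : X = {v} := by
          obtain ⟨w, rfl⟩ := Set.ncard_eq_one.1 (show X.ncard = 1 by omega)
          rw [show v = w from hvX]
        subst hX
        rw [Set.ncard_singleton]
        omega
    · have h2 := ncard_comps_pend_le (U := Xᶜ) hvX huv
      rw [hins] at h2
      rcases X.eq_empty_or_nonempty with rfl | hX0
      · rw [Set.compl_empty] at hle h2 ⊢
        have h3 := (hsmall (insert u ∅) (by rw [hcu, Set.ncard_empty]; omega)).ncard_comps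
        rw [h3] at h2
        rw [Set.ncard_empty, mul_zero, Nat.le_zero, Set.ncard_eq_zero (Set.toFinite _),
          Set.eq_empty_iff_forall_notMem]
        rintro D ⟨hD, hDs⟩
        apply hsun
        have : D = Set.univ := by
          rw [Set.eq_univ_iff_forall]
          intro x
          obtain ⟨E, hE, hxE⟩ := exists_isCompOn (pend G u v) (Set.mem_univ x)
          have := (Set.ncard_le_one (Set.toFinite _)).1 h2 D hD E hE
          exact this ▸ hxE
        exact this ▸ hDs
      · have hpos : 0 < X.ncard := (Set.ncard_pos (Set.toFinite _)).2 hX0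
        rcases le_or_gt (k + 2) (insert u X).ncard with hb | hb
        · have := hbig _ hb; omega
        · have := hmid (insert u X) (by omega); omega
  obtain ⟨t, tn, tc, t0, -, hrest⟩ := (fac_of_kan hK).exists_path_of_leaf (Set.mem_univ u)
    (w := v) fun y _ h => h.2.1 rfl
  refine exists_isPathFactor (l₁ := []) (l₂ := t) tn (tc.imp fun a b h => h.1) ?_
    (hrest.mono fun a _ b _ h => h.1)
  have := List.length_pos_of_ne_nil t0
  simp; omega

theorem isPathFactorUniform_of_nbhd [Finite V] {G : SimpleGraph V} {k : ℕ} (hk : 1 ≤ k) {γ : ℝ}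
    (hγ : 1 / 3 ≤ γ) (hγ' : γ ≤ 1) (hG : G.IsKConnected (k + 2))
    (h : ∀ A : Set V, G.IsIndepSet A → A.ncard = ⌊γ * (2 * (k : ℝ) + 1)⌋₊ →
      ((G.nbhd A).ncard : ℝ) > γ * ((Nat.card V : ℝ) - 3 * (k : ℝ) - 2) + (k : ℝ) + 2) :
    G.IsPathFactorUniform 3 := by
  intro e he
  induction e using Sym2.ind with
  | _ p q =>
  have hconn : ∀ X : Set V, X.ncard < k + 1 + 1 → ConnOn G Xᶜ := fun X hX =>
    connOn_of_connected (hG.2 X hX)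
  have hcard := hG.1
  refine isPathFactorCovered_of_comps hk (by omega) ?_ ?_ ?_
  · intro X hX
    have h1 := ncard_comps_deleteEdges_le G p q Xᶜ
    have h2 := ncard_comps_le_of_nbhd hγ hγ' h hX
    omega
  · intro X hX
    have h1 := ncard_comps_deleteEdges_le G p q Xᶜ
    rw [(hconn X (by omega)).ncard_comps] at h1
    exact h1
  · intro X hX
    exact connOn_deleteEdges (k := k + 1) (by omega) hconn (by omega)

end Factors

/-! ### Sharpness -/

/-- The join of the complete graph on `k + 1` vertices with `2k + 1` disjoint edges. -/
def sharpGraph (k : ℕ) : SimpleGraph (Fin (k + 1) ⊕ Fin (2 * k + 1) × Bool) where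
  Adj a b := a ≠ b ∧ ∀ i j, a = Sum.inr i → b = Sum.inr j → i.1 = j.1
  symm := ⟨fun _ _ h => ⟨h.1.symm, fun i j hi hj => (h.2 j i hj hi).symm⟩⟩
  loopless := ⟨fun _ h => h.1 rfl⟩

theorem sharpGraph_adj_inl {k : ℕ} {i : Fin (k + 1)} {b : Fin (k + 1) ⊕ Fin (2 * k + 1) × Bool}
    (h : b ≠ Sum.inl i) : (sharpGraph k).Adj (Sum.inl i) b :=
  ⟨h.symm, fun _ _ hi _ => by simp at hi⟩

theorem natCard_sharpGraph (k : ℕ) :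
    Nat.card (Fin (k + 1) ⊕ Fin (2 * k + 1) × Bool) = 5 * k + 3 := by
  simp; ring

theorem isKConnected_sharpGraph (k : ℕ) : (sharpGraph k).IsKConnected (k + 1) := by
  refine ⟨by rw [natCard_sharpGraph]; omega, fun X hX => ?_⟩
  obtain ⟨i, hi⟩ : ∃ i : Fin (k + 1), Sum.inl i ∉ X := by
    by_contra hcon
    push Not at hcon
    have h1 : Set.range (Sum.inl : Fin (k + 1) → Fin (k + 1) ⊕ Fin (2 * k + 1) × Bool) ⊆ X := by
      rintro _ ⟨i, rfl⟩; exact hcon i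
    have h2 := Set.ncard_le_ncard h1 (Set.toFinite _)
    rw [← Set.image_univ, Set.ncard_image_of_injective _ Sum.inl_injective, Set.ncard_univ,
      Nat.card_eq_fintype_card, Fintype.card_fin] at h2
    omega
  have hreach : ∀ b : (Xᶜ : Set _), ((sharpGraph k).induce Xᶜ).Reachable ⟨Sum.inl i, hi⟩ b := by
    intro b
    by_cases hb : b.1 = Sum.inl i
    · have : b = ⟨Sum.inl i, hi⟩ := Subtype.ext hb
      rw [this]
    · exact SimpleGraph.Adj.reachable (sharpGraph_adj_inl hb)
  have : Nonempty (Xᶜ : Set _) := ⟨⟨Sum.inl i, hi⟩⟩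
  exact ⟨fun a b => (hreach a).symm.trans (hreach b)⟩

/-- An independent set is either one clique vertex, adjacent to everything else, or avoids the
clique. In the latter case it sees the clique and the distinct partners of its own vertices. -/
theorem ncard_nbhd_sharpGraph {k b : ℕ} (hb : 1 ≤ b)
    {A : Set (Fin (k + 1) ⊕ Fin (2 * k + 1) × Bool)} (hA : (sharpGraph k).IsIndepSet A)
    (hAc : A.ncard = b) : b + k + 1 ≤ ((sharpGraph k).nbhd A).ncard := by
  have hmem : ∀ a ∈ A, ∀ w, (sharpGraph k).Adj a w → w ∈ (sharpGraph k).nbhd A :=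
    fun a ha w hw => Set.mem_biUnion ha hw
  by_cases hl : ∃ i, Sum.inl i ∈ A
  · obtain ⟨i, hi⟩ := hl
    have hA1 : A = {Sum.inl i} := by
      refine Set.eq_singleton_iff_unique_mem.2 ⟨hi, fun y hy => ?_⟩
      by_contra hne
      exact hA hi hy (Ne.symm hne) (sharpGraph_adj_inl hne)
    have hb1 : b = 1 := by rw [← hAc, hA1, Set.ncard_singleton]
    have hsub : ({Sum.inl i} : Set (Fin (k + 1) ⊕ Fin (2 * k + 1) × Bool))ᶜ ⊆
        (sharpGraph k).nbhd A := fun w hw => hmem _ hi w (sharpGraph_adj_inl hw)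
    have h1 := Set.ncard_le_ncard hsub (Set.toFinite _)
    have h2 := Set.ncard_add_ncard_compl
      ({Sum.inl i} : Set (Fin (k + 1) ⊕ Fin (2 * k + 1) × Bool))
    rw [natCard_sharpGraph, Set.ncard_singleton] at h2
    omega
  · push Not at hl
    let f : Fin (k + 1) ⊕ Fin (2 * k + 1) × Bool → Fin (k + 1) ⊕ Fin (2 * k + 1) × Bool :=
      Sum.map id fun q => (q.1, !q.2)
    have hf : Function.Injective f := by
      refine Function.Injective.sumMap Function.injective_id fun q r h => ?_
      have h1 := congrArg Prod.fst h
      have h2 := congrArg Prod.snd h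
      simp at h1 h2
      exact Prod.ext h1 h2
    obtain ⟨a, ha⟩ := Set.nonempty_of_ncard_ne_zero (s := A) (by omega)
    have hsub : Set.range (Sum.inl : Fin (k + 1) → Fin (k + 1) ⊕ Fin (2 * k + 1) × Bool) ∪ f '' A ⊆
        (sharpGraph k).nbhd A := by
      rintro w (⟨i, rfl⟩ | ⟨c, hc, rfl⟩)
      · refine hmem a ha _ (sharpGraph_adj_inl ?_).symm
        rintro rfl
        exact hl i ha
      · refine hmem c hc _ ?_
        rcases c with i | q
        · exact absurd hc (hl i)
        · refine ⟨?_, ?_⟩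
          · intro h
            have h1 : q = (q.1, !q.2) := Sum.inr_injective h
            have h2 := congrArg Prod.snd h1
            simp at h2
          · rintro i j hi hj
            have h1 : q = i := Sum.inr_injective hi
            have h2 : (q.1, !q.2) = j := Sum.inr_injective hj
            rw [← h1, ← h2]
    have h1 := Set.ncard_le_ncard hsub (Set.toFinite _)
    rw [Set.ncard_union_eq, ← Set.image_univ, Set.ncard_image_of_injective _ Sum.inl_injective,
      Set.ncard_image_of_injective _ hf, hAc, Set.ncard_univ, Nat.card_eq_fintype_card,
      Fintype.card_fin] at h1
    · omega
    · rw [Set.disjoint_left]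
      rintro _ ⟨i, rfl⟩ ⟨c, hc, h⟩
      rcases c with j | q
      · exact hl j hc
      · simp [f] at h

section PathFactor

variable {V : Type u} {G H : SimpleGraph V} {d : ℕ}

/-- Every vertex has at most two neighbours in a path factor. -/
theorem eq_or_eq_of_isPathFactor (hH : SimpleGraph.IsPathFactor d G H) {v a b c : V}
    (ha : H.Adj v a) (hb : H.Adj v b) (hc : H.Adj v c) : a = b ∨ a = c ∨ b = c := by
  obtain ⟨m, -, ⟨φ⟩⟩ := hH.2 (H.connectedComponentMk v)
  have hs : ∀ w, H.Adj v w → w ∈ (H.connectedComponentMk v).supp := fun w hw => by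
    rw [SimpleGraph.ConnectedComponent.mem_supp_iff, SimpleGraph.ConnectedComponent.eq]
    exact (SimpleGraph.Adj.reachable hw).symm
  have hv : v ∈ (H.connectedComponentMk v).supp := rfl
  have key : ∀ w (hw : H.Adj v w), (φ ⟨v, hv⟩).1 + 1 = (φ ⟨w, hs w hw⟩).1 ∨
      (φ ⟨w, hs w hw⟩).1 + 1 = (φ ⟨v, hv⟩).1 := fun w hw => by
    rw [← SimpleGraph.pathGraph_adj, φ.map_adj_iff]
    exact hw
  have hinj : ∀ w w' (hw : H.Adj v w) (hw' : H.Adj v w'),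
      (φ ⟨w, hs w hw⟩).1 = (φ ⟨w', hs w' hw'⟩).1 → w = w' := fun w w' hw hw' h =>
    congrArg Subtype.val (φ.injective (Fin.ext h))
  have h1 := key a ha
  have h2 := key b hb
  have h3 := key c hc
  by_cases hab : (φ ⟨a, hs a ha⟩).1 = (φ ⟨b, hs b hb⟩).1
  · exact Or.inl (hinj a b ha hb hab)
  by_cases hac : (φ ⟨a, hs a ha⟩).1 = (φ ⟨c, hs c hc⟩).1
  · exact Or.inr (Or.inl (hinj a c ha hc hac))
  · exact Or.inr (Or.inr (hinj b c hb hc (by omega)))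

/-- In a path factor, some edge leaves every nonempty set of fewer than `d` vertices. -/
theorem exists_adj_of_isPathFactor [Finite V] (hH : SimpleGraph.IsPathFactor d G H) {S : Set V}
    (hS : S.Nonempty) (hd : S.ncard < d) : ∃ a ∈ S, ∃ b ∉ S, H.Adj a b := by
  by_contra hcon
  push Not at hcon
  obtain ⟨v, hv⟩ := hS
  obtain ⟨m, hm, ⟨φ⟩⟩ := hH.2 (H.connectedComponentMk v)
  have hwalk : ∀ x y : V, H.Walk x y → x ∈ S → y ∈ S := by
    intro x y w
    induction w with
    | nil => exact id
    | cons hab _ ih =>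
      intro hx
      apply ih
      by_contra h
      exact hcon _ hx _ h hab
  have hsub : (H.connectedComponentMk v).supp ⊆ S := by
    intro x hx
    rw [SimpleGraph.ConnectedComponent.mem_supp_iff, SimpleGraph.ConnectedComponent.eq] at hx
    obtain ⟨w⟩ := hx.symm
    exact hwalk _ _ w hv
  have h1 := Set.ncard_le_ncard hsub (Set.toFinite _)
  have h2 : (H.connectedComponentMk v).supp.ncard = m := by
    rw [← Nat.card_coe_set_eq, ← Nat.card_fin m]
    exact Nat.card_congr φ.toEquiv
  omega

end PathFactor

theorem not_mem_isPathFactor_sharpGraph {k : ℕ} (hk : 1 ≤ k)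
    {H : SimpleGraph (Fin (k + 1) ⊕ Fin (2 * k + 1) × Bool)}
    (hH : SimpleGraph.IsPathFactor 3 (sharpGraph k) H) :
    ¬ H.Adj (Sum.inl 0) (Sum.inl ⟨1, by omega⟩) := by
  classical
  intro hadj
  -- A pair is too small to be a union of components of the factor, and its only outside neighbours
  -- are in the clique.
  have hpair : ∀ i : Fin (2 * k + 1), ∃ c : Bool, ∃ x : Fin (k + 1),
      H.Adj (Sum.inl x) (Sum.inr (i, c)) := by
    intro i
    obtain ⟨a, ha, b, hb, hab⟩ := exists_adj_of_isPathFactor hH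
      (S := {Sum.inr (i, true), Sum.inr (i, false)}) (by simp)
      (by rw [Set.ncard_pair (by simp)]; omega)
    obtain ⟨c, rfl⟩ : ∃ c, a = Sum.inr (i, c) := by
      rcases ha with rfl | ha
      · exact ⟨_, rfl⟩
      · exact ⟨_, ha⟩
    rcases b with x | ⟨j, c'⟩
    · exact ⟨c, x, hab.symm⟩
    · exfalso
      have hij : i = j := (hH.1 hab).2 _ _ rfl rfl
      subst hij
      apply hb
      cases c' <;> simp
  choose c x hx using hpair
  -- Degrees in the factor are at most two, and clique vertices `0` and `1` spend one on their
  -- common edge. The capacities sum to `2 + 2(k - 1) = 2k`, against `2k + 1` pairs.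
  have hfib : ∀ y ∈ (Finset.univ : Finset (Fin (k + 1))),
      (Finset.univ.filter fun i => x i = y).card ≤ if y.1 ≤ 1 then 1 else 2 := by
    intro y _
    split_ifs with hy
    · rw [Finset.card_le_one]
      intro i hi j hj
      simp only [Finset.mem_filter, Finset.mem_univ, true_and] at hi hj
      by_contra hij
      obtain ⟨z, hz⟩ : ∃ z : Fin (k + 1), H.Adj (Sum.inl y) (Sum.inl z) := by
        rcases Nat.le_one_iff_eq_zero_or_eq_one.1 hy with h | h
        · have : y = 0 := Fin.ext h
          exact ⟨_, this ▸ hadj⟩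
        · have : y = ⟨1, by omega⟩ := Fin.ext h
          exact ⟨_, this ▸ hadj.symm⟩
      have h1 := hx i
      have h2 := hx j
      rw [hi] at h1
      rw [hj] at h2
      rcases eq_or_eq_of_isPathFactor hH h1 h2 hz with h | h | h
      · exact hij (congrArg Prod.fst (Sum.inr_injective h))
      · simp at h
      · simp at h
    · by_contra hcon
      push Not at hcon
      obtain ⟨i, j, l, hi, hj, hl, hij, hil, hjl⟩ := Finset.two_lt_card_iff.1 hcon
      simp only [Finset.mem_filter, Finset.mem_univ, true_and] at hi hj hl
      have h1 := hx i
      have h2 := hx j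
      have h3 := hx l
      rw [hi] at h1
      rw [hj] at h2
      rw [hl] at h3
      rcases eq_or_eq_of_isPathFactor hH h1 h2 h3 with h | h | h
      · exact hij (congrArg Prod.fst (Sum.inr_injective h))
      · exact hil (congrArg Prod.fst (Sum.inr_injective h))
      · exact hjl (congrArg Prod.fst (Sum.inr_injective h))
  have h1 := Finset.card_eq_sum_card_fiberwise (s := (Finset.univ : Finset (Fin (2 * k + 1))))
    (t := (Finset.univ : Finset (Fin (k + 1)))) (f := x) (fun _ _ => by simp)
  have h2 := Finset.sum_le_sum hfib
  rw [← h1, Finset.card_univ, Fintype.card_fin, Fin.sum_univ_eq_sum_range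
    (fun y => if y ≤ 1 then 1 else 2)] at h2
  obtain ⟨r, rfl⟩ : ∃ r, k = r + 1 := ⟨k - 1, by omega⟩
  rw [Finset.sum_range_succ', Finset.sum_range_succ'] at h2
  simp at h2
  omega

/-- A factor of the graph minus an edge is a factor of the graph itself, so it suffices to delete
one of the disjoint edges and test a clique edge. -/
theorem not_isPathFactorUniform_sharpGraph {k : ℕ} (hk : 1 ≤ k) :
    ¬ (sharpGraph k).IsPathFactorUniform 3 := by
  intro h
  have he : s(Sum.inr (0, true), Sum.inr (0, false)) ∈ (sharpGraph k).edgeSet := by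
    rw [SimpleGraph.mem_edgeSet]
    refine ⟨by simp, fun i j hi hj => ?_⟩
    rw [← Sum.inr_injective hi, ← Sum.inr_injective hj]
  have hf : s(Sum.inl 0, Sum.inl ⟨1, by omega⟩) ∈ ((sharpGraph k).deleteEdges
      {s(Sum.inr (0, true), Sum.inr (0, false))}).edgeSet := by
    rw [SimpleGraph.mem_edgeSet, SimpleGraph.deleteEdges_adj]
    refine ⟨sharpGraph_adj_inl ?_, by simp⟩
    intro h
    have := congrArg Fin.val (Sum.inl_injective h)
    simp at this
  obtain ⟨H, hH, hadj⟩ := h _ he _ hf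
  exact not_mem_isPathFactor_sharpGraph hk
    ⟨hH.1.trans (SimpleGraph.deleteEdges_le _), hH.2⟩ hadj

end PathFac

theorem theorem1p4 (k : ℕ) (hk : 1 ≤ k) (γ : ℝ) (hγ : 1 / 3 ≤ γ) (hγ' : γ ≤ 1) :
    (∀ (V : Type u) [Finite V] (G : SimpleGraph V),
      G.IsKConnected (k + 2) →
      (Nat.card V : ℝ) ≥ 5 * (k : ℝ) + 3 - 3 / (5 * γ - 1) →
      (∀ A : Set V, G.IsIndepSet A → A.ncard = ⌊γ * (2 * (k : ℝ) + 1)⌋₊ →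
        ((G.nbhd A).ncard : ℝ) > γ * ((Nat.card V : ℝ) - 3 * (k : ℝ) - 2) + (k : ℝ) + 2) →
      G.IsPathFactorUniform 3) ∧
    ((∃ b : ℕ, γ = (b : ℝ) / (2 * (k : ℝ) + 1)) →
      ∃ (W : Type) (_ : Finite W) (G : SimpleGraph W),
        Nat.card W = 5 * k + 3 ∧
        (Nat.card W : ℝ) ≥ 5 * (k : ℝ) + 3 - 3 / (5 * γ - 1) ∧
        G.IsKConnected (k + 1) ∧
        (∀ A : Set W, G.IsIndepSet A → A.ncard = ⌊γ * (2 * (k : ℝ) + 1)⌋₊ →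
          ((G.nbhd A).ncard : ℝ) ≥ γ * ((Nat.card W : ℝ) - 3 * (k : ℝ) - 2) + (k : ℝ) + 1) ∧
        ¬ G.IsPathFactorUniform 3) := by
  have hk0 : (0 : ℝ) ≤ k := Nat.cast_nonneg k
  refine ⟨fun V _ G hG _ h => PathFac.isPathFactorUniform_of_nbhd hk hγ hγ' hG h, ?_⟩
  rintro ⟨b, hb⟩
  have hpos : (0 : ℝ) < 2 * (k : ℝ) + 1 := by linarith
  have hγb : γ * (2 * (k : ℝ) + 1) = b := by rw [hb]; field_simp
  have hfl : ⌊γ * (2 * (k : ℝ) + 1)⌋₊ = b := by rw [hγb, Nat.floor_natCast]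
  have hb1 : 1 ≤ b := by
    have : (0 : ℝ) < b := by rw [← hγb]; exact mul_pos (by linarith) hpos
    exact_mod_cast this
  have hcard := PathFac.natCard_sharpGraph k
  have hcard' : (Nat.card (Fin (k + 1) ⊕ Fin (2 * k + 1) × Bool) : ℝ) = 5 * k + 3 := by
    rw [hcard]; push_cast; ring
  refine ⟨_, inferInstance, PathFac.sharpGraph k, hcard, ?_, PathFac.isKConnected_sharpGraph k, ?_,
    PathFac.not_isPathFactorUniform_sharpGraph hk⟩
  · have : 0 ≤ 3 / (5 * γ - 1) := div_nonneg (by norm_num) (by linarith)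
    rw [hcard']
    linarith
  · intro A hA hAc
    have hN := PathFac.ncard_nbhd_sharpGraph hb1 hA (hAc.trans hfl)
    have hN' : (b : ℝ) + k + 1 ≤ ((PathFac.sharpGraph k).nbhd A).ncard := by exact_mod_cast hN
    -- At order `5k + 3` the factor `n - 3k - 2` equals `2k + 1`, so the threshold is exactly `b + k
    -- + 1`.
    have : γ * (5 * (k : ℝ) + 3 - 3 * k - 2) = b := by rw [← hγb]; ring
    rw [hcard', this]
    exact hN'
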